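/- For a nonnegative integer $n$, let $DSOME(n)$ denote the sum of all the odd parts occurring in the partitions of $n$ into distinct parts, minus the sum of all the even parts occurring in those partitions (both sums taken over all partitions of $n$ into distinct parts; $DSOME(0)=0$). Then for all integers $n\ge 0$ and $1\le r\le 4$, $$DSOME(625n+125r+26)\equiv 0 \pmod 8.$$ -/

import Mathlib

/-- `DSOME n` is the sum of all the odd parts occurring in the partitions of `n` into distinct
parts, minus the sum of all the even parts occurring in those partitions. -/
def DSOME (n : ℕ) : ℤ :=
  (∑ p ∈ Nat.Partition.distincts n, ((p.parts.filter (fun k => Odd k)).sum : ℤ)) -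
    ∑ p ∈ Nat.Partition.distincts n, ((p.parts.filter (fun k => Even k)).sum : ℤ)

/-! Write E = ∏(1 - q^n), φ = ∑ (-1)^m q^(m²) = E²/E(q²) and D = ∏(1 + q^n) = E/φ. The generating
function G of `DSOME` satisfies 8G = D - Eφ³ (`eight_mul_mk_dsome`). Indeed, G is a Wronskian of the
products over odd and over even parts, and squaring Jacobi's series for E³ and rotating the lattice
by 45° expresses that Wronskian through E⁶. The claim thus becomes the divisibility by 64 of certain
coefficients of D - Eφ³.

Let U_r extract the exponents 5n + r (`sect r`). Since φ⁴ ≡ 1 mod 8, the difference between D - Eφ³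
and Eφ³ - Eφ⁷, which is D(1 - φ⁴)², vanishes mod 64. Five identities give U₁ of Eφ³, Eφ⁵, Eφ⁷ and U₀
of E⁵φ, E⁵φ³ as combinations of similar products and of series in q⁵ (times q for U₀). Following 26
= 1 + 5(0 + 5·1), the composite U₁U₀U₁ leaves a series in q⁵ plus a multiple of 64
(`exists_sect_eq`). At the exponents 5n + r with 1 ≤ r ≤ 4 only the multiple of 64 survives.

The five identities come from a rational parametrisation. Comparing residue classes mod 5 in E² =
φE(q²) shows that, up to E(q⁵) and φ(q⁵), the sections of E and φ are rational in two quantities u,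
r with qu⁵ = (r - 1)/(r(2r - 1)²) (`curve_of_dissection`). The undissected E and φ are tied to u and
r by the Hecke operator at 5 acting on φ² and on E⁶, both computed with Gaussian integers, and by a
product formula for the sections of φ. Each identity is then one between rational functions. -/

namespace QSeries
open PowerSeries Filter Finset

/-! ### X-adic limits and infinite products. -/

section XLim

variable {R S : Type*} [CommRing R] [CommRing S]

/-- `X`-adic convergence of a sequence of power series. -/
def XLim (f : ℕ → R⟦X⟧) (L : R⟦X⟧) : Prop :=
  ∀ d : ℕ, ∀ᶠ N in atTop, (X : R⟦X⟧) ^ d ∣ f N - L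

theorem eq_of_forall_X_pow_dvd_sub {f g : R⟦X⟧} (h : ∀ d : ℕ, (X : R⟦X⟧) ^ d ∣ f - g) : f = g := by
  ext n
  have := X_pow_dvd_iff.1 (h (n + 1)) n (Nat.lt_succ_self n)
  rwa [map_sub, sub_eq_zero] at this

theorem XLim.unique {f : ℕ → R⟦X⟧} {L L' : R⟦X⟧} (h : XLim f L) (h' : XLim f L') : L = L' := by
  refine eq_of_forall_X_pow_dvd_sub fun d ↦ ?_
  obtain ⟨N, h1, h2⟩ := ((h d).and (h' d)).exists
  have := dvd_sub h2 h1
  rwa [sub_sub_sub_cancel_left] at this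

theorem xLim_const (L : R⟦X⟧) : XLim (fun _ ↦ L) L := fun d ↦ by simp

theorem XLim.mul {f g : ℕ → R⟦X⟧} {L K : R⟦X⟧} (hf : XLim f L) (hg : XLim g K) :
    XLim (fun N ↦ f N * g N) (L * K) := fun d ↦ by
  filter_upwards [hf d, hg d] with N h1 h2
  have : f N * g N - L * K = (f N - L) * g N + L * (g N - K) := by ring
  rw [this]
  exact dvd_add (h1.mul_right _) (h2.mul_left _)

theorem XLim.pow {f : ℕ → R⟦X⟧} {L : R⟦X⟧} (hf : XLim f L) (k : ℕ) :
    XLim (fun N ↦ f N ^ k) (L ^ k) := by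
  induction k with
  | zero => simpa using xLim_const (1 : R⟦X⟧)
  | succ k ih => simpa only [pow_succ] using ih.mul hf

theorem XLim.comp {f : ℕ → R⟦X⟧} {L : R⟦X⟧} (hf : XLim f L) {u : ℕ → ℕ}
    (hu : Tendsto u atTop atTop) : XLim (fun N ↦ f (u N)) L := fun d ↦ hu.eventually (hf d)

theorem XLim.map {f : ℕ → R⟦X⟧} {L : R⟦X⟧} (hf : XLim f L) (g : R⟦X⟧ →+* S⟦X⟧)
    (hg : (X : S⟦X⟧) ∣ g X) : XLim (fun N ↦ g (f N)) (g L) := fun d ↦ by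
  filter_upwards [hf d] with N h
  rw [← map_sub]
  obtain ⟨c, hc⟩ := h
  rw [hc, map_mul, map_pow]
  exact (pow_dvd_pow_of_dvd hg d).mul_right _

/-- The infinite product of a sequence of power series. -/
noncomputable def iprod (f : ℕ → R⟦X⟧) : R⟦X⟧ :=
  .mk fun n ↦ coeff n (∏ i ∈ range (n + 1), f i)

theorem X_pow_dvd_prod_sub_prod {f : ℕ → R⟦X⟧} (hf : ∀ n, (X : R⟦X⟧) ^ n ∣ f n - 1) {d N : ℕ}
    (h : d ≤ N) : (X : R⟦X⟧) ^ d ∣ ∏ i ∈ range N, f i - ∏ i ∈ range d, f i := by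
  induction N, h using Nat.le_induction with
  | base => simp
  | succ N h ih =>
    rw [prod_range_succ]
    have : (∏ i ∈ range N, f i) * f N - ∏ i ∈ range d, f i =
      (∏ i ∈ range N, f i) * (f N - 1) + (∏ i ∈ range N, f i - ∏ i ∈ range d, f i) := by ring
    rw [this]
    exact dvd_add (((pow_dvd_pow _ h).trans (hf N)).mul_left _) ih

/-- Factors of index at least n + 1 are 1 modulo X^(n+1), so coefficient n is already final after n
+ 1 factors, which is where `iprod` reads it. -/
theorem X_pow_dvd_prod_sub_iprod {f : ℕ → R⟦X⟧} (hf : ∀ n, (X : R⟦X⟧) ^ n ∣ f n - 1) (N : ℕ) :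
    (X : R⟦X⟧) ^ N ∣ ∏ i ∈ range N, f i - iprod f := by
  rw [X_pow_dvd_iff]
  intro m hm
  have := X_pow_dvd_iff.1 (X_pow_dvd_prod_sub_prod hf (Nat.succ_le_of_lt hm)) m
    (Nat.lt_succ_self m)
  simpa [iprod] using this

theorem xLim_iprod {f : ℕ → R⟦X⟧} (hf : ∀ n, (X : R⟦X⟧) ^ n ∣ f n - 1) :
    XLim (fun N ↦ ∏ i ∈ range N, f i) (iprod f) := fun d ↦ by
  filter_upwards [eventually_ge_atTop d] with N hN
  exact (pow_dvd_pow _ hN).trans (X_pow_dvd_prod_sub_iprod hf N)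

theorem isUnit_of_X_dvd_sub_one {f : R⟦X⟧} (h : (X : R⟦X⟧) ∣ f - 1) : IsUnit f := by
  rw [isUnit_iff_constantCoeff]
  rw [X_dvd_iff, map_sub, map_one, sub_eq_zero] at h
  simp [h]

end XLim

/-! ### Series given by weights and exponents on an arbitrary index set. -/

section FormalSum

variable {ι κ R S : Type*} [CommRing R] [CommRing S]

/-- The formal series `∑ i, w i * X ^ e i`. -/
noncomputable def formalSum (w : ι → R) (e : ι → ℕ) : R⟦X⟧ :=
  .mk fun n ↦ ∑ᶠ (i) (_ : e i = n), w i

/-- Only finitely many indices have exponent at most `n`. -/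
def FinFibers (e : ι → ℕ) : Prop := ∀ n : ℕ, {i | e i ≤ n}.Finite

theorem coeff_formalSum (w : ι → R) (e : ι → ℕ) (n : ℕ) :
    coeff n (formalSum w e) = ∑ᶠ (i) (_ : e i = n), w i := coeff_mk _ _

theorem coeff_formalSum_eq_sum {e : ι → ℕ} (w : ι → R) {s : Finset ι} {n : ℕ}
    (hs : ∀ i, e i = n → i ∈ s) :
    coeff n (formalSum w e) = ∑ i ∈ s, if e i = n then w i else 0 := by
  classical
  rw [coeff_formalSum, ← Finset.sum_filter]
  apply finsum_cond_eq_sum_of_cond_iff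
  intro i _
  simp only [mem_filter]
  exact ⟨fun h ↦ ⟨hs i h, h⟩, fun h ↦ h.2⟩

theorem FinFibers.prod {e : ι → ℕ} {e' : κ → ℕ} (he : FinFibers e) (he' : FinFibers e') :
    FinFibers (fun p : ι × κ ↦ e p.1 + e' p.2) := fun n ↦
  ((he n).prod (he' n)).subset fun p hp ↦ by
    simp only [Set.mem_ofPred_eq, Set.mem_prod] at hp ⊢
    omega

theorem formalSum_mul {e : ι → ℕ} {e' : κ → ℕ} (he : FinFibers e) (he' : FinFibers e')
    (w : ι → R) (w' : κ → R) :
    formalSum w e * formalSum w' e' =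
      formalSum (fun p : ι × κ ↦ w p.1 * w' p.2) (fun p ↦ e p.1 + e' p.2) := by
  classical
  ext n
  rw [coeff_mul]
  have h1 : ∀ p ∈ antidiagonal n, coeff p.1 (formalSum w e) * coeff p.2 (formalSum w' e') =
      ∑ i ∈ (he n).toFinset, ∑ j ∈ (he' n).toFinset,
        if e i = p.1 ∧ e' j = p.2 then w i * w' j else 0 := by
    intro p hp
    rw [HasAntidiagonal.mem_antidiagonal] at hp
    rw [coeff_formalSum_eq_sum w (s := (he n).toFinset) (by intro i hi; simp; omega),
      coeff_formalSum_eq_sum w' (s := (he' n).toFinset) (by intro i hi; simp; omega), sum_mul_sum]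
    refine sum_congr rfl fun i _ ↦ sum_congr rfl fun j _ ↦ ?_
    by_cases h1 : e i = p.1 <;> by_cases h2 : e' j = p.2 <;> simp [h1, h2]
  rw [sum_congr rfl h1, coeff_formalSum_eq_sum _ (s := (he n).toFinset ×ˢ (he' n).toFinset)
    (by rintro ⟨i, j⟩ h; simp at h ⊢; omega), sum_comm, sum_product]
  refine sum_congr rfl fun i _ ↦ ?_
  rw [sum_comm]
  refine sum_congr rfl fun j _ ↦ ?_
  by_cases h : e i + e' j = n
  · rw [if_pos h, sum_eq_single (e i, e' j)]
    · simp
    · rintro ⟨a, b⟩ _ hb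
      rw [if_neg]
      rintro ⟨rfl, rfl⟩
      exact hb rfl
    · intro h'; simp [h] at h'
  · rw [if_neg h]
    refine sum_eq_zero fun p hp ↦ if_neg ?_
    rintro ⟨h1, h2⟩
    rw [HasAntidiagonal.mem_antidiagonal] at hp
    omega

theorem formalSum_comp_equiv (σ : κ ≃ ι) (w : ι → R) (e : ι → ℕ) :
    formalSum (fun k ↦ w (σ k)) (fun k ↦ e (σ k)) = formalSum w e := by
  ext n
  rw [coeff_formalSum, coeff_formalSum]
  exact finsum_comp_equiv (f := fun i ↦ ∑ᶠ (_ : e i = n), w i) σ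

theorem X_pow_dvd_formalSum_sub {e : ι → ℕ} (w : ι → R) {s : Finset ι} {N : ℕ}
    (hs : ∀ i, e i < N → i ∈ s) :
    (X : R⟦X⟧) ^ N ∣ formalSum w e - ∑ i ∈ s, C (w i) * X ^ e i := by
  rw [X_pow_dvd_iff]
  intro m hm
  rw [map_sub, coeff_formalSum_eq_sum w (s := s) (by intro i hi; exact hs i (by omega)), map_sum,
    ← sum_sub_distrib]
  refine sum_eq_zero fun i _ ↦ ?_
  rw [coeff_C_mul, coeff_X_pow]
  by_cases h : e i = m
  · simp [h]
  · simp [h, Ne.symm h]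

end FormalSum
end QSeries

namespace QSeries
open PowerSeries Filter Finset

/-! ### The Jacobi triple product, by a finite form and a limit. -/

section TripleProduct

variable {K : Type*} [CommRing K]

/-- The finite product `(Q; Q)_n`. -/
noncomputable def qFact (Q : K⟦X⟧) (n : ℕ) : K⟦X⟧ := ∏ k ∈ range n, (1 - Q ^ (k + 1))

theorem qFact_succ (Q : K⟦X⟧) (n : ℕ) : qFact Q (n + 1) = qFact Q n * (1 - Q ^ (n + 1)) :=
  prod_range_succ _ _

theorem isUnit_qFact {Q : K⟦X⟧} (hQ : X ∣ Q) (n : ℕ) : IsUnit (qFact Q n) := by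
  refine IsUnit.prod_iff.2 fun k _ ↦ isUnit_of_X_dvd_sub_one ?_
  rw [sub_sub_cancel_left]
  exact (dvd_pow hQ (Nat.succ_ne_zero k)).neg_right

/-- The reciprocal of `(Q; Q)_n`, extended by zero to negative `n`. -/
noncomputable def qFactInv (Q : K⟦X⟧) (n : ℤ) : K⟦X⟧ :=
  if n < 0 then 0 else Ring.inverse (qFact Q n.toNat)

theorem qFactInv_of_neg (Q : K⟦X⟧) {n : ℤ} (h : n < 0) : qFactInv Q n = 0 := if_pos h

theorem qFact_mul_qFactInv {Q : K⟦X⟧} (hQ : X ∣ Q) (n : ℕ) : qFact Q n * qFactInv Q n = 1 := by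
  rw [qFactInv, if_neg (by omega), Int.toNat_natCast]
  exact Ring.mul_inverse_cancel _ (isUnit_qFact hQ n)

theorem qFactInv_sub_one {Q : K⟦X⟧} (hQ : X ∣ Q) (n : ℕ) :
    qFactInv Q (n - 1) = qFactInv Q n * (1 - Q ^ n) := by
  cases n with
  | zero => simp [qFactInv_of_neg]
  | succ n =>
    have h1 := qFact_mul_qFactInv hQ n
    have h2 := qFact_mul_qFactInv hQ (n + 1)
    rw [qFact_succ] at h2
    rw [Nat.cast_succ, add_sub_cancel_right]
    apply (isUnit_qFact hQ n).mul_left_cancel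
    push_cast at h2
    linear_combination h1 - h2

/-- The truncated exponent n - 1 is harmless at n = 0, where the factor 1 - Q^0 vanishes. -/
theorem qFactInv_sub_two {Q : K⟦X⟧} (hQ : X ∣ Q) (n : ℕ) :
    qFactInv Q (n - 2) = qFactInv Q n * (1 - Q ^ n) * (1 - Q ^ (n - 1)) := by
  cases n with
  | zero => simp [qFactInv_of_neg]
  | succ n =>
    rw [← qFactInv_sub_one hQ]
    have := qFactInv_sub_one hQ n
    rw [Nat.add_sub_cancel, show ((n + 1 : ℕ) : ℤ) - 1 = n by push_cast; ring, ← this]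
    congr 1
    push_cast
    ring

/-- A two-step Pascal rule for central Gaussian binomial coefficients. -/
theorem qFact_pascal {Q : K⟦X⟧} (hQ : X ∣ Q) {p s n : ℕ} (h : p + s = n + 2) :
    qFact Q (n + 2) * qFactInv Q p * qFactInv Q s =
      qFact Q n * (qFactInv Q (p - 1) * qFactInv Q (s - 1) * (1 + Q ^ (n + 1)) +
        Q ^ s * (qFactInv Q (p - 2) * qFactInv Q s) +
        Q ^ p * (qFactInv Q p * qFactInv Q (s - 2))) := by
  rw [qFactInv_sub_one hQ, qFactInv_sub_one hQ, qFactInv_sub_two hQ, qFactInv_sub_two hQ,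
    qFact_succ, qFact_succ]
  have key : (1 - Q ^ (n + 1)) * (1 - Q ^ (n + 2)) =
      (1 - Q ^ p) * (1 - Q ^ s) * (1 + Q ^ (n + 1)) + Q ^ s * (1 - Q ^ p) * (1 - Q ^ (p - 1)) +
        Q ^ p * (1 - Q ^ s) * (1 - Q ^ (s - 1)) := by
    rcases p with _ | p
    · obtain rfl : s = n + 2 := by omega
      simp only [pow_zero, sub_self]
      rw [show n + 2 - 1 = n + 1 by omega]
      ring
    rcases s with _ | s
    · obtain rfl : p = n + 1 := by omega
      simp only [pow_zero, sub_self, Nat.add_sub_cancel]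
      ring
    obtain rfl : n = p + s := by omega
    simp only [Nat.add_sub_cancel]
    ring
  linear_combination (qFact Q n * qFactInv Q p * qFactInv Q s) * key

/-- Triangular numbers, indexed by the integers. -/
def tri (m : ℤ) : ℕ := (m * (m + 1) / 2).toNat

theorem two_mul_tri (m : ℤ) : 2 * (tri m : ℤ) = m * (m + 1) := by
  have h0 : 0 ≤ m * (m + 1) := by
    rcases le_or_gt 0 m with h | h
    · positivity
    · nlinarith
  have h1 : m * (m + 1) % 2 = 0 := Int.even_iff.1 (Int.even_mul_succ_self m)
  rw [tri]
  omega

theorem tri_sub_one (m : ℤ) : (tri (m - 1) : ℤ) = tri m - m := by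
  have h1 := two_mul_tri m
  have h2 := two_mul_tri (m - 1)
  linarith

/-- The exponents in the triple product identity. -/
def tpExp (i j : ℕ) (m : ℤ) : ℕ := i * tri m + j * tri (m - 1)

/-- This gives finite fibres and the rate of convergence in the triple product. The + 1 is needed:
for i = 0 and m = 1 the exponent is 0. -/
theorem natAbs_le_tpExp {i j : ℕ} (h : 0 < i + j) (m : ℤ) : m.natAbs ≤ tpExp i j m + 1 := by
  have h1 := two_mul_tri m
  have h2 := tri_sub_one m
  have h3 : (m.natAbs : ℤ) ≤ tri m + 1 := by
    rcases le_or_gt 0 m with h | h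
    · rw [Int.natAbs_of_nonneg h]; nlinarith
    · rw [Int.ofNat_natAbs_of_nonpos h.le]; nlinarith [sq_nonneg (m + 2)]
  have h4 : (m.natAbs : ℤ) ≤ tri (m - 1) + 1 := by
    rcases le_or_gt 0 m with h | h
    · rw [Int.natAbs_of_nonneg h]; nlinarith [sq_nonneg (m - 2)]
    · rw [Int.ofNat_natAbs_of_nonpos h.le]; nlinarith
  rw [tpExp]
  rcases Nat.eq_zero_or_pos i with rfl | hi
  · have : 1 * tri (m - 1) ≤ j * tri (m - 1) := Nat.mul_le_mul_right _ (by omega)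
    omega
  · have : 1 * tri m ≤ i * tri m := Nat.mul_le_mul_right _ hi
    have : 0 ≤ j * tri (m - 1) := Nat.zero_le _
    omega

theorem finFibers_tpExp {i j : ℕ} (h : 0 < i + j) : FinFibers (tpExp i j) := fun n ↦
  (Set.finite_Icc (-(n + 1 : ℤ)) (n + 1)).subset fun m hm ↦ by
    have := natAbs_le_tpExp h m
    simp only [Set.mem_ofPred_eq, Set.mem_Icc] at hm ⊢
    omega

/-- The terms in the triple product identity. -/
noncomputable def tpTerm (α : Kˣ) (i j : ℕ) (m : ℤ) : K⟦X⟧ :=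
  C (((-α) ^ m : Kˣ) : K) * X ^ tpExp i j m

/-- Multiplying by the linear part of a new factor shifts the theta terms by one and leaves a power
of Q, exactly the power found in `tpCoeff_succ`. `tpTerm_succ` treats the other factor. -/
theorem tpTerm_pred (α : Kˣ) (i j N : ℕ) {m : ℤ} {s : ℕ} (hm : s = (N : ℤ) + 1 - m) :
    -(C (α : K) * X ^ i * (X ^ (i + j)) ^ N) * tpTerm α i j (m - 1) =
      tpTerm α i j m * (X ^ (i + j)) ^ s := by
  have h1 : i + (i + j) * N + tpExp i j (m - 1) = tpExp i j m + (i + j) * s := by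
    zify
    simp only [tpExp, Nat.cast_add, Nat.cast_mul, tri_sub_one, hm]
    ring
  have h2 : ((-α) ^ m : Kˣ) = (-α) * (-α) ^ (m - 1) := by rw [← zpow_one_add]; congr 1; ring
  simp only [tpTerm]
  rw [h2, Units.val_mul, Units.val_neg, map_mul, map_neg, ← pow_mul, ← pow_mul]
  calc _ = -C (α : K) * C (((-α) ^ (m - 1) : Kˣ) : K) *
        X ^ (i + (i + j) * N + tpExp i j (m - 1)) := by ring
    _ = _ := by rw [h1]; ring

theorem tpTerm_succ (α : Kˣ) (i j N : ℕ) {m : ℤ} {s : ℕ} (hm : s = (N : ℤ) + 1 + m) :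
    -(C ((α⁻¹ : Kˣ) : K) * X ^ j * (X ^ (i + j)) ^ N) * tpTerm α i j (m + 1) =
      tpTerm α i j m * (X ^ (i + j)) ^ s := by
  have h1 : j + (i + j) * N + tpExp i j (m + 1) = tpExp i j m + (i + j) * s := by
    have := tri_sub_one (m + 1)
    zify
    simp only [tpExp, Nat.cast_add, Nat.cast_mul, tri_sub_one, hm]
    rw [add_sub_cancel_right] at this
    linear_combination (-i - j : ℤ) * this
  have h2 : ((-α) ^ m : Kˣ) = (-α⁻¹) * (-α) ^ (m + 1) := by
    rw [zpow_add_one, mul_comm _ (-α), ← mul_assoc]; simp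
  simp only [tpTerm]
  rw [h2, Units.val_mul, Units.val_neg, map_mul, map_neg, ← pow_mul, ← pow_mul]
  calc _ = -C ((α⁻¹ : Kˣ) : K) * C (((-α) ^ (m + 1) : Kˣ) : K) *
        X ^ (j + (i + j) * N + tpExp i j (m + 1)) := by ring
    _ = _ := by rw [h1]; ring

/-- The coefficients in the finite triple product identity. -/
noncomputable def tpCoeff (Q : K⟦X⟧) (N : ℕ) (m : ℤ) : K⟦X⟧ :=
  qFact Q (2 * N) * qFactInv Q (N + m) * qFactInv Q (N - m)

theorem tpCoeff_eq_zero (Q : K⟦X⟧) {N : ℕ} {m : ℤ} (h : m ∉ Set.Icc (-N : ℤ) N) :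
    tpCoeff Q N m = 0 := by
  rw [tpCoeff]
  by_cases h' : (N : ℤ) + m < 0
  · simp [qFactInv_of_neg Q h']
  · rw [qFactInv_of_neg Q (n := (N : ℤ) - m) (by simp only [Set.mem_Icc] at h; omega), mul_zero]

theorem finite_support_tpCoeff (Q : K⟦X⟧) (N : ℕ) (w : ℤ → K⟦X⟧) :
    (Function.support fun m ↦ w m * tpCoeff Q N m).Finite :=
  (Set.finite_Icc (-N : ℤ) N).subset fun m hm ↦ by
    by_contra h
    exact hm (by simp [tpCoeff_eq_zero Q h])

/-- The finite triple product. -/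
noncomputable def finTP (α : Kˣ) (i j N : ℕ) : K⟦X⟧ :=
  ∏ n ∈ range N, ((1 - C (α : K) * X ^ i * (X ^ (i + j)) ^ n) *
    (1 - C ((α⁻¹ : Kˣ) : K) * X ^ j * (X ^ (i + j)) ^ n))

/-- These are the central Gaussian binomials [2N choose N + m], so this is the two-step Pascal rule.
Where `toNat` truncates a negative exponent, the coefficient it multiplies is zero. -/
theorem tpCoeff_succ {Q : K⟦X⟧} (hQ : X ∣ Q) (N : ℕ) (m : ℤ) :
    tpCoeff Q (N + 1) m = tpCoeff Q N m * (1 + Q ^ (2 * N + 1)) +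
      Q ^ ((N : ℤ) + 1 - m).toNat * tpCoeff Q N (m - 1) +
      Q ^ ((N : ℤ) + 1 + m).toNat * tpCoeff Q N (m + 1) := by
  by_cases h : m ∈ Set.Icc (-(N + 1 : ℕ) : ℤ) (N + 1 : ℕ)
  · simp only [Set.mem_Icc] at h
    obtain ⟨p, hp⟩ := Int.eq_ofNat_of_zero_le (show 0 ≤ (N : ℤ) + 1 + m by omega)
    obtain ⟨s, hs⟩ := Int.eq_ofNat_of_zero_le (show 0 ≤ (N : ℤ) + 1 - m by omega)
    have := qFact_pascal hQ (p := p) (s := s) (n := 2 * N) (by omega)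
    simp only [tpCoeff]
    rw [hp, hs, Int.toNat_natCast, Int.toNat_natCast,
      show (N + 1 : ℕ) + m = (p : ℤ) by push_cast; exact hp,
      show (N + 1 : ℕ) - m = (s : ℤ) by push_cast; exact hs,
      show (N : ℤ) + m = p - 1 by omega, show (N : ℤ) - m = s - 1 by omega,
      show (N : ℤ) + (m - 1) = p - 2 by omega, show (N : ℤ) - (m - 1) = s by omega,
      show (N : ℤ) + (m + 1) = p by omega, show (N : ℤ) - (m + 1) = s - 2 by omega,
      show 2 * (N + 1) = 2 * N + 2 by ring, this]
    ring
  · rw [tpCoeff_eq_zero Q h]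
    simp only [Set.mem_Icc] at h
    rw [tpCoeff_eq_zero Q, tpCoeff_eq_zero Q, tpCoeff_eq_zero Q] <;>
      simp only [Set.mem_Icc, zero_mul, mul_zero, add_zero] <;> omega

/-- Finite form of the **Jacobi triple product identity**. -/
theorem finTP_eq_finsum (α : Kˣ) {i j : ℕ} (h : 0 < i + j) (N : ℕ) :
    finTP α i j N = ∑ᶠ m : ℤ, tpTerm α i j m * tpCoeff (X ^ (i + j)) N m := by
  have hQ : (X : K⟦X⟧) ∣ X ^ (i + j) := dvd_pow_self _ h.ne'
  induction N with
  | zero =>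
    rw [finsum_eq_single _ 0]
    · have := qFact_mul_qFactInv hQ 0
      simp [qFact] at this
      simp [finTP, tpTerm, tpCoeff, tpExp, tri, qFact, this]
    · intro m hm
      rw [tpCoeff_eq_zero, mul_zero]
      simpa using hm
  | succ N ih =>
    set Q : K⟦X⟧ := X ^ (i + j) with hQdef
    set a : K⟦X⟧ := C (α : K) * X ^ i * Q ^ N with ha
    set b : K⟦X⟧ := C ((α⁻¹ : Kˣ) : K) * X ^ j * Q ^ N with hb
    have hab : a * b = Q ^ (2 * N + 1) := by
      have : C (α : K) * C ((α⁻¹ : Kˣ) : K) = (1 : K⟦X⟧) := by rw [← map_mul]; simp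
      calc a * b = (C (α : K) * C ((α⁻¹ : Kˣ) : K)) * (X ^ (i + j)) * Q ^ (2 * N) := by
            rw [ha, hb]; ring
        _ = _ := by rw [this, ← hQdef]; ring
    have e1 : finTP α i j (N + 1) = finTP α i j N * (1 - a) * (1 - b) := by
      rw [finTP, prod_range_succ, ← finTP, mul_assoc (finTP α i j N)]
    -- Expanding (1 - a)(1 - b) with ab = Q^(2N+1) yields three sums, matched to the three terms of
    -- the Pascal rule by shifting m.
    have e2 : finTP α i j (N + 1) = finTP α i j N * (1 + Q ^ (2 * N + 1)) +
        finTP α i j N * (-a) + finTP α i j N * (-b) := by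
      rw [e1, ← hab]; ring
    have s1 := finite_support_tpCoeff Q N (fun m ↦ (1 + Q ^ (2 * N + 1)) * tpTerm α i j m)
    have s2 := finite_support_tpCoeff Q N (fun m ↦ -a * tpTerm α i j m)
    have s3 := finite_support_tpCoeff Q N (fun m ↦ -b * tpTerm α i j m)
    have t2 : (Function.support fun m ↦
        -a * tpTerm α i j (m - 1) * tpCoeff Q N (m - 1)).Finite := s2.preimage ((Equiv.subRight (1 : ℤ)).injective.injOn)
    have t3 : (Function.support fun m ↦
        -b * tpTerm α i j (m + 1) * tpCoeff Q N (m + 1)).Finite := s3.preimage ((Equiv.addRight (1 : ℤ)).injective.injOn)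
    have s0 := finite_support_tpCoeff Q N (tpTerm α i j)
    rw [e2, ih, finsum_mul' _ _ s0, finsum_mul' _ _ s0, finsum_mul' _ _ s0]
    have r1 : ∑ᶠ m, tpTerm α i j m * tpCoeff Q N m * (1 + Q ^ (2 * N + 1)) =
        ∑ᶠ m, (1 + Q ^ (2 * N + 1)) * tpTerm α i j m * tpCoeff Q N m :=
      finsum_congr fun m ↦ by ring
    have r2 : ∑ᶠ m, tpTerm α i j m * tpCoeff Q N m * (-a) =
        ∑ᶠ m, -a * tpTerm α i j (m - 1) * tpCoeff Q N (m - 1) := by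
      rw [← finsum_comp_equiv (Equiv.subRight (1 : ℤ))]
      exact finsum_congr fun m ↦ by simp only [Equiv.subRight_apply]; ring
    have r3 : ∑ᶠ m, tpTerm α i j m * tpCoeff Q N m * (-b) =
        ∑ᶠ m, -b * tpTerm α i j (m + 1) * tpCoeff Q N (m + 1) := by
      rw [← finsum_comp_equiv (Equiv.addRight (1 : ℤ))]
      exact finsum_congr fun m ↦ by simp only [Equiv.coe_addRight]; ring
    rw [r1, r2, r3, ← finsum_add_distrib s1 t2,
      ← finsum_add_distrib ((s1.union t2).subset (Function.support_add _ _)) t3]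
    refine finsum_congr fun m ↦ ?_
    rw [tpCoeff_succ hQ]
    have c2 : -a * tpTerm α i j (m - 1) * tpCoeff Q N (m - 1) =
        tpTerm α i j m * Q ^ ((N : ℤ) + 1 - m).toNat * tpCoeff Q N (m - 1) := by
      by_cases hm : m ≤ N + 1
      · rw [ha, tpTerm_pred α i j N (m := m) (s := ((N : ℤ) + 1 - m).toNat) (by omega)]
      · rw [tpCoeff_eq_zero Q (by simp only [Set.mem_Icc]; omega), mul_zero, mul_zero]
    have c3 : -b * tpTerm α i j (m + 1) * tpCoeff Q N (m + 1) =
        tpTerm α i j m * Q ^ ((N : ℤ) + 1 + m).toNat * tpCoeff Q N (m + 1) := by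
      by_cases hm : -(N + 1 : ℤ) ≤ m
      · rw [hb, tpTerm_succ α i j N (m := m) (s := ((N : ℤ) + 1 + m).toNat) (by omega)]
      · rw [tpCoeff_eq_zero Q (by simp only [Set.mem_Icc]; omega), mul_zero, mul_zero]
    rw [c2, c3]
    ring

theorem X_pow_dvd_qFact_sub {Q : K⟦X⟧} (hQ : X ∣ Q) {k n : ℕ} (h : k ≤ n) :
    (X : K⟦X⟧) ^ (k + 1) ∣ qFact Q n - qFact Q k := by
  induction n, h using Nat.le_induction with
  | base => simp
  | succ n h ih =>
    rw [qFact_succ, mul_sub, mul_one, sub_right_comm]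
    exact dvd_sub ih (((pow_dvd_pow _ (by omega)).trans (pow_dvd_pow_of_dvd hQ _)).mul_left _)

/-- All four q-factorials involved have length at least d = N - |m|, hence agree with (Q; Q)_d
modulo X^(d+1) and cancel. -/
theorem X_pow_dvd_tpCoeff_mul_sub_one {Q : K⟦X⟧} (hQ : X ∣ Q) {N : ℕ} {m : ℤ}
    (h : m.natAbs ≤ N) :
    (X : K⟦X⟧) ^ (N - m.natAbs + 1) ∣ tpCoeff Q N m * qFact Q N - 1 := by
  obtain ⟨p, hp⟩ := Int.eq_ofNat_of_zero_le (show 0 ≤ (N : ℤ) + m by omega)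
  obtain ⟨s, hs⟩ := Int.eq_ofNat_of_zero_le (show 0 ≤ (N : ℤ) - m by omega)
  set d := N - m.natAbs with hd
  rw [tpCoeff, hp, hs]
  let π := Ideal.Quotient.mk (Ideal.span {(X : K⟦X⟧) ^ (d + 1)})
  have hπ : ∀ n, d ≤ n → π (qFact Q n) = π (qFact Q d) := fun n hn ↦ by
    rw [Ideal.Quotient.eq, Ideal.mem_span_singleton]
    exact X_pow_dvd_qFact_sub hQ hn
  have h1 : π (qFact Q d) * π (qFactInv Q p) = 1 := by
    rw [← hπ p (by omega), ← map_mul, qFact_mul_qFactInv hQ, map_one]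
  have h2 : π (qFact Q d) * π (qFactInv Q s) = 1 := by
    rw [← hπ s (by omega), ← map_mul, qFact_mul_qFactInv hQ, map_one]
  rw [← Ideal.mem_span_singleton, ← Ideal.Quotient.eq]
  change π _ = π 1
  rw [map_mul, map_mul, map_mul, hπ (2 * N) (by omega), hπ N (by omega), map_one, h1, one_mul,
    mul_comm, h2]

/-- The **Jacobi triple product identity** for formal power series. -/
theorem jacobi_triple_product (α : Kˣ) {i j : ℕ} (h : 0 < i + j) :
    XLim (fun N ↦ finTP α i j N * qFact (X ^ (i + j)) N)
      (formalSum (fun m : ℤ ↦ (((-α) ^ m : Kˣ) : K)) (tpExp i j)) := by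
  intro d
  have hQ : (X : K⟦X⟧) ∣ X ^ (i + j) := dvd_pow_self _ h.ne'
  filter_upwards [eventually_ge_atTop d] with N hN
  refine (pow_dvd_pow _ hN).trans ?_
  have h1 := X_pow_dvd_formalSum_sub (e := tpExp i j) (fun m : ℤ ↦ (((-α) ^ m : Kˣ) : K))
    (s := Finset.Icc (-N : ℤ) N) (N := N) (by
      intro m hm
      have := natAbs_le_tpExp h m
      simp only [Finset.mem_Icc]
      omega)
  have h2 : (X : K⟦X⟧) ^ N ∣ finTP α i j N * qFact (X ^ (i + j)) N -
      ∑ m ∈ Finset.Icc (-N : ℤ) N, C (((-α) ^ m : Kˣ) : K) * X ^ tpExp i j m := by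
    rw [finTP_eq_finsum α h, finsum_eq_sum_of_support_subset (s := Finset.Icc (-N : ℤ) N) _
      (fun m hm ↦ by
        by_contra hm'
        refine hm ?_
        dsimp only
        rw [tpCoeff_eq_zero _ (by simpa using hm'), mul_zero]), sum_mul, ← sum_sub_distrib]
    refine dvd_sum fun m hm ↦ ?_
    simp only [Finset.mem_Icc] at hm
    have h3 := natAbs_le_tpExp h m
    have h4 := X_pow_dvd_tpCoeff_mul_sub_one hQ (N := N) (m := m) (by omega)
    have h5 : tpTerm α i j m * tpCoeff (X ^ (i + j)) N m * qFact (X ^ (i + j)) N -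
        C (((-α) ^ m : Kˣ) : K) * X ^ tpExp i j m = C (((-α) ^ m : Kˣ) : K) *
        (X ^ tpExp i j m * (tpCoeff (X ^ (i + j)) N m * qFact (X ^ (i + j)) N - 1)) := by
      rw [tpTerm]; ring
    rw [h5]
    -- The term has order at least |m| - 1 and its error factor at least N - |m| + 1, together at
    -- least N.
    refine Dvd.dvd.mul_left (Dvd.dvd.trans ?_ (mul_dvd_mul_left _ h4)) _
    rw [← pow_add]
    exact pow_dvd_pow _ (by omega)
  have := dvd_sub h2 h1
  rwa [sub_sub_sub_cancel_right] at this

end TripleProduct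
end QSeries

namespace QSeries
open PowerSeries Filter Finset

/-! ### Eta products and theta series as cases of the triple product. -/

section Products

variable {R : Type*} [CommRing R]

/-- Euler's product `∏ (1 - X ^ (n + 1))`. -/
noncomputable def euler : ℤ⟦X⟧ := iprod fun n ↦ 1 - X ^ (n + 1)

/-- The product `∏ (1 - X ^ (2 * n + 1))`. -/
noncomputable def eulerOdd : ℤ⟦X⟧ := iprod fun n ↦ 1 - X ^ (2 * n + 1)

/-- The product `∏ (1 + X ^ (n + 1))`. -/
noncomputable def distinctSeries : ℤ⟦X⟧ := iprod fun n ↦ 1 + X ^ (n + 1)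

/-- The product `∏ (1 + X ^ (2 * n + 1))`. -/
noncomputable def oddDistinctSeries : ℤ⟦X⟧ := iprod fun n ↦ 1 + X ^ (2 * n + 1)

/-- The product `∏ (1 + X ^ (2 * n + 2))`. -/
noncomputable def evenDistinctSeries : ℤ⟦X⟧ := iprod fun n ↦ 1 + X ^ (2 * n + 2)

/-- The substitution `X ↦ X ^ k`. -/
noncomputable abbrev dil (k : ℕ) [NeZero k] : ℤ⟦X⟧ →+* ℤ⟦X⟧ :=
  (PowerSeries.expand (R := ℤ) k (NeZero.ne k)).toRingHom

theorem dil_X (k : ℕ) [NeZero k] : dil k X = X ^ k := PowerSeries.expand_X k (NeZero.ne k)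

theorem coeff_dil (k : ℕ) [NeZero k] (f : ℤ⟦X⟧) (n : ℕ) :
    coeff n (dil k f) = if k ∣ n then coeff (n / k) f else 0 :=
  PowerSeries.coeff_expand k (NeZero.ne k) f

theorem coeff_dil_mul (k : ℕ) [NeZero k] (f : ℤ⟦X⟧) (n : ℕ) :
    coeff (k * n) (dil k f) = coeff n f :=
  PowerSeries.coeff_expand_mul k (NeZero.ne k) f n

theorem X_dvd_dil_X (k : ℕ) [NeZero k] : (X : ℤ⟦X⟧) ∣ dil k X := by
  rw [dil_X]; exact dvd_pow_self _ (NeZero.ne k)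

theorem xLim_prod_one_sub (α : R) {u : ℕ → ℕ} (hu : ∀ n, n ≤ u n) :
    XLim (fun N ↦ ∏ n ∈ range N, (1 - C α * X ^ u n)) (iprod fun n ↦ 1 - C α * X ^ u n) :=
  xLim_iprod fun n ↦ by
    rw [sub_sub_cancel_left]
    exact ((pow_dvd_pow _ (hu n)).mul_left _).neg_right

theorem xLim_one_sub {u : ℕ → ℕ} (hu : ∀ n, n ≤ u n) :
    XLim (fun N ↦ ∏ n ∈ range N, (1 - X ^ u n : R⟦X⟧)) (iprod fun n ↦ 1 - X ^ u n) := by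
  simpa using xLim_prod_one_sub (1 : R) hu

theorem xLim_one_add {u : ℕ → ℕ} (hu : ∀ n, n ≤ u n) :
    XLim (fun N ↦ ∏ n ∈ range N, (1 + X ^ u n : R⟦X⟧)) (iprod fun n ↦ 1 + X ^ u n) := by
  simpa using xLim_prod_one_sub (-1 : R) hu

theorem xLim_euler : XLim (fun N ↦ ∏ n ∈ range N, (1 - X ^ (n + 1))) euler :=
  xLim_one_sub fun n ↦ by omega

theorem xLim_eulerOdd : XLim (fun N ↦ ∏ n ∈ range N, (1 - X ^ (2 * n + 1))) eulerOdd :=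
  xLim_one_sub fun n ↦ by omega

theorem xLim_distinctSeries : XLim (fun N ↦ ∏ n ∈ range N, (1 + X ^ (n + 1))) distinctSeries :=
  xLim_one_add fun n ↦ by omega

theorem xLim_oddDistinctSeries :
    XLim (fun N ↦ ∏ n ∈ range N, (1 + X ^ (2 * n + 1))) oddDistinctSeries :=
  xLim_one_add fun n ↦ by omega

theorem xLim_evenDistinctSeries :
    XLim (fun N ↦ ∏ n ∈ range N, (1 + X ^ (2 * n + 2))) evenDistinctSeries :=
  xLim_one_add fun n ↦ by omega

theorem xLim_qFact_dil (k : ℕ) [NeZero k] : XLim (fun N ↦ qFact (X ^ k) N) (dil k euler) := by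
  have := xLim_euler.map (dil k) (X_dvd_dil_X k)
  simpa only [map_prod, map_sub, map_one, map_pow, dil_X, qFact] using this

theorem tendsto_mul_atTop' {k : ℕ} (hk : 0 < k) : Tendsto (fun N : ℕ ↦ k * N) atTop atTop :=
  tendsto_id.const_mul_atTop' hk

theorem prod_range_mul_left {M : Type*} [CommMonoid M] (k N : ℕ) (f : ℕ → M) :
    ∏ n ∈ range (k * N), f n = ∏ n ∈ range N, ∏ r ∈ range k, f (k * n + r) := by
  induction N with
  | zero => simp
  | succ N ih => rw [Nat.mul_succ, prod_range_add, ih, prod_range_succ]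

theorem distinctSeries_mul_euler : distinctSeries * euler = dil 2 euler := by
  refine (xLim_distinctSeries.mul xLim_euler).unique ?_
  convert xLim_qFact_dil 2 using 2 with N
  rw [← prod_mul_distrib, qFact]
  refine prod_congr rfl fun n _ ↦ ?_
  ring

theorem oddDistinctSeries_mul_evenDistinctSeries :
    oddDistinctSeries * evenDistinctSeries = distinctSeries := by
  refine (xLim_oddDistinctSeries.mul xLim_evenDistinctSeries).unique ?_
  convert xLim_distinctSeries.comp (tendsto_mul_atTop' (k := 2) (by norm_num)) using 2 with N
  rw [← prod_mul_distrib, prod_range_mul_left]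
  exact prod_congr rfl fun n _ ↦ by rw [prod_range_succ, prod_range_one, add_zero, add_assoc]

theorem eulerOdd_mul : eulerOdd * dil 2 euler = euler := by
  refine (xLim_eulerOdd.mul (xLim_qFact_dil 2)).unique ?_
  convert xLim_euler.comp (tendsto_mul_atTop' (k := 2) (by norm_num)) using 2 with N
  rw [qFact, ← prod_mul_distrib, prod_range_mul_left]
  refine prod_congr rfl fun n _ ↦ ?_
  rw [prod_range_succ, prod_range_one]
  ring

/-- The theta series `∑ (-1) ^ m * X ^ (m ^ 2)`. -/
noncomputable def phi : ℤ⟦X⟧ := formalSum (fun m : ℤ ↦ (m.negOnePow : ℤ)) fun m ↦ m.natAbs ^ 2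

theorem finFibers_sq : FinFibers fun m : ℤ ↦ m.natAbs ^ 2 := fun n ↦
  (Set.finite_Icc (-n : ℤ) n).subset fun m hm ↦ by
    simp only [Set.mem_ofPred_eq, Set.mem_Icc] at hm ⊢
    have : m.natAbs ≤ m.natAbs ^ 2 := Nat.le_self_pow two_ne_zero _
    omega

theorem tpExp_one_one : tpExp 1 1 = fun m ↦ m.natAbs ^ 2 := by
  ext m
  have h1 := two_mul_tri m
  zify
  simp only [tpExp, Nat.cast_add, Nat.cast_mul, tri_sub_one, sq_abs]
  push_cast
  linarith

theorem phi_eq_eulerOdd : phi = eulerOdd ^ 2 * dil 2 euler := by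
  have h := jacobi_triple_product (1 : ℤˣ) (i := 1) (j := 1) (by norm_num)
  rw [tpExp_one_one] at h
  refine h.unique ?_
  convert (xLim_eulerOdd.pow 2).mul (xLim_qFact_dil 2) using 2 with N
  congr 1
  rw [finTP, ← prod_pow]
  refine prod_congr rfl fun n _ ↦ ?_
  simp
  ring

/-- The theta series `∑ X ^ (m ^ 2)`. -/
noncomputable def thetaSq : ℤ⟦X⟧ := formalSum (fun _ : ℤ ↦ (1 : ℤ)) fun m ↦ m.natAbs ^ 2

theorem thetaSq_eq : thetaSq = oddDistinctSeries ^ 2 * dil 2 euler := by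
  have h := jacobi_triple_product (-1 : ℤˣ) (i := 1) (j := 1) (by norm_num)
  rw [tpExp_one_one] at h
  simp only [neg_neg, one_zpow, Units.val_one] at h
  refine h.unique ?_
  convert (xLim_oddDistinctSeries.pow 2).mul (xLim_qFact_dil 2) using 2 with N
  congr 1
  rw [finTP, ← prod_pow]
  refine prod_congr rfl fun n _ ↦ ?_
  simp
  ring

/-- The theta series `∑ X ^ (m * (m + 1))` over all integers `m`. -/
noncomputable def thetaPronic : ℤ⟦X⟧ := formalSum (fun _ : ℤ ↦ (1 : ℤ)) fun m ↦ 2 * tri m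

/-- With i = 0 the first factor of the triple product is 1 + X^0 = 2. Splitting it off is the reason
for taking N + 1 factors in the limit. -/
theorem thetaPronic_eq : thetaPronic = 2 * (evenDistinctSeries ^ 2 * dil 2 euler) := by
  have h := jacobi_triple_product (-1 : ℤˣ) (i := 0) (j := 2) (by norm_num)
  simp only [neg_neg, one_zpow, Units.val_one] at h
  have e1 : formalSum (fun _ : ℤ ↦ (1 : ℤ)) (tpExp 0 2) = thetaPronic := by
    have := formalSum_comp_equiv (Equiv.subRight (1 : ℤ)) (fun _ ↦ (1 : ℤ)) fun m ↦ 2 * tri m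
    rw [thetaPronic, ← this]
    congr 1
    ext m
    simp [tpExp]
  rw [e1] at h
  refine (h.comp (tendsto_add_atTop_nat 1)).unique ?_
  convert ((xLim_const (2 : ℤ⟦X⟧)).mul ((xLim_evenDistinctSeries.mul
    (xLim_evenDistinctSeries.comp (tendsto_add_atTop_nat 1))).mul
    ((xLim_qFact_dil 2).comp (tendsto_add_atTop_nat 1)))) using 2 with N
  · rw [← mul_assoc]
    congr 1
    rw [finTP, prod_mul_distrib, prod_range_succ', mul_comm (∏ n ∈ range N, _), ← mul_assoc]
    congr 1
    · congr 1
      · simp; norm_num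
      · refine prod_congr rfl fun n _ ↦ ?_
        simp
        ring
    · refine prod_congr rfl fun n _ ↦ ?_
      simp
      ring
  · rw [sq]

theorem phi_mul : phi * dil 2 euler = euler ^ 2 := by
  rw [phi_eq_eulerOdd]
  linear_combination (eulerOdd * dil 2 euler + euler) * eulerOdd_mul

theorem distinctSeries_mul_phi : distinctSeries * phi = euler := by
  have : (dil 2 euler) ≠ 0 := by
    intro h
    have h1 := coeff_dil_mul 2 euler 0
    rw [h] at h1
    simp [euler, iprod] at h1
  apply mul_right_cancel₀ this
  linear_combination distinctSeries * phi_mul + euler * distinctSeries_mul_euler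

/-- **Euler's pentagonal number theorem**. -/
theorem euler_eq_formalSum :
    euler = formalSum (fun m : ℤ ↦ (m.negOnePow : ℤ)) (tpExp 1 2) := by
  have h := jacobi_triple_product (1 : ℤˣ) (i := 1) (j := 2) (by norm_num)
  refine XLim.unique ?_ h
  convert xLim_euler.comp (tendsto_mul_atTop' (k := 3) (by norm_num)) using 2 with N
  rw [finTP, qFact, ← prod_mul_distrib, prod_range_mul_left]
  refine prod_congr rfl fun n _ ↦ ?_
  rw [prod_range_succ, prod_range_succ, prod_range_one]
  simp
  ring

/-- The component of `phi` on exponents congruent to one modulo five, halved and negated. -/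
noncomputable def phiOne : ℤ⟦X⟧ := formalSum (fun m : ℤ ↦ (m.negOnePow : ℤ)) (tpExp 7 3)

/-- The component of `phi` on exponents congruent to four modulo five, halved. -/
noncomputable def phiFour : ℤ⟦X⟧ := formalSum (fun m : ℤ ↦ (m.negOnePow : ℤ)) (tpExp 9 1)

theorem dil_ten (f : ℤ⟦X⟧) : dil 10 f = dil 5 (dil 2 f) :=
  PowerSeries.expand_mul 5 (by norm_num) 2 (by norm_num) f

theorem eulerOdd_dil_five : dil 5 eulerOdd * dil 10 euler = dil 5 euler := by
  rw [dil_ten, ← map_mul, eulerOdd_mul]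

theorem xLim_dil_five_eulerOdd :
    XLim (fun N ↦ ∏ n ∈ range N, (1 - X ^ (10 * n + 5))) (dil 5 eulerOdd) := by
  have := xLim_eulerOdd.map (dil 5) (X_dvd_dil_X 5)
  simp only [map_prod, map_sub, map_one, map_pow, dil_X] at this
  convert this using 4 with N n
  ring

/-- The two triple products supply the exponents 7, 3, 9, 1 mod 10; the factor from `dil 5 phi`
supplies 5, completing the odd integers. -/
theorem phiOne_mul_phiFour :
    phiOne * phiFour * dil 5 phi = eulerOdd * dil 5 eulerOdd * dil 10 euler ^ 3 := by
  have hX := jacobi_triple_product (1 : ℤˣ) (i := 7) (j := 3) (by norm_num)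
  have hY := jacobi_triple_product (1 : ℤˣ) (i := 9) (j := 1) (by norm_num)
  have hP : dil 5 phi = dil 5 eulerOdd ^ 2 * dil 10 euler := by
    rw [phi_eq_eulerOdd, map_mul, map_pow, dil_ten]
  rw [hP]
  have hE := xLim_qFact_dil 10
  have hO := xLim_dil_five_eulerOdd
  refine ((hX.mul hY).mul ((hO.pow 2).mul hE)).unique ?_
  convert ((xLim_eulerOdd.comp (tendsto_mul_atTop' (k := 5) (by norm_num))).mul hO).mul
    (hE.pow 3) using 2 with N
  have e1 : finTP (1 : ℤˣ) 7 3 N * finTP (1 : ℤˣ) 9 1 N * ∏ n ∈ range N, (1 - X ^ (10 * n + 5)) =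
      ∏ n ∈ range (5 * N), (1 - X ^ (2 * n + 1)) := by
    rw [finTP, finTP, ← prod_mul_distrib, ← prod_mul_distrib, prod_range_mul_left]
    refine prod_congr rfl fun n _ ↦ ?_
    simp [prod_range_succ]
    ring
  simp only [← e1, Nat.reduceAdd]
  ring

/-- In the parametrisation this becomes the relation linking φ/E to u and r. -/
theorem phiOne_mul_phiFour_mul :
    phiOne * phiFour * dil 5 phi ^ 3 * euler = phi * dil 5 euler ^ 5 := by
  have h1 := phiOne_mul_phiFour
  have h2 := eulerOdd_dil_five
  have h3 : dil 5 phi * dil 10 euler = dil 5 euler ^ 2 := by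
    rw [dil_ten, ← map_mul, phi_mul, map_pow]
  have h4 : phi = eulerOdd * euler := by
    rw [phi_eq_eulerOdd]; linear_combination eulerOdd * eulerOdd_mul
  calc _ = (phiOne * phiFour * dil 5 phi) * dil 5 phi ^ 2 * euler := by ring
    _ = eulerOdd * (dil 5 eulerOdd * dil 10 euler) * (dil 5 phi * dil 10 euler) ^ 2 * euler := by
        rw [h1]; ring
    _ = _ := by rw [h2, h3, h4]; ring

end Products
end QSeries

namespace QSeries
open PowerSeries Filter Finset

/-! ### Linear operations on formal sums, and the derivation q d/dq. -/

section FormalSumLemmas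

variable {ι κ R S : Type*} [CommRing R] [CommRing S]

theorem map_coeff_formalSum {e : ι → ℕ} (he : FinFibers e) (g : R →+ S) (w : ι → R) (n : ℕ) :
    g (coeff n (formalSum w e)) = coeff n (formalSum (fun i ↦ g (w i)) e) := by
  rw [coeff_formalSum_eq_sum w (s := (he n).toFinset) (by intro i hi; simp; omega),
    coeff_formalSum_eq_sum _ (s := (he n).toFinset) (by intro i hi; simp; omega), map_sum]
  refine sum_congr rfl fun i _ ↦ ?_
  split_ifs <;> simp

theorem formalSum_sub {e : ι → ℕ} (he : FinFibers e) (w w' : ι → R) :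
    formalSum (fun i ↦ w i - w' i) e = formalSum w e - formalSum w' e := by
  ext n
  have hs : ∀ i, e i = n → i ∈ (he n).toFinset := by intro i hi; simp; omega
  rw [map_sub, coeff_formalSum_eq_sum _ hs, coeff_formalSum_eq_sum _ hs,
    coeff_formalSum_eq_sum _ hs, ← sum_sub_distrib]
  refine sum_congr rfl fun i _ ↦ ?_
  split_ifs <;> simp

theorem formalSum_add {e : ι → ℕ} (he : FinFibers e) (w w' : ι → R) :
    formalSum (fun i ↦ w i + w' i) e = formalSum w e + formalSum w' e := by
  ext n
  have hs : ∀ i, e i = n → i ∈ (he n).toFinset := by intro i hi; simp; omega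
  rw [map_add, coeff_formalSum_eq_sum _ hs, coeff_formalSum_eq_sum _ hs,
    coeff_formalSum_eq_sum _ hs, ← sum_add_distrib]
  refine sum_congr rfl fun i _ ↦ ?_
  split_ifs <;> simp

theorem formalSum_sumElim {e : ι → ℕ} {e' : κ → ℕ} (he : FinFibers e) (he' : FinFibers e')
    (w : ι → R) (w' : κ → R) :
    formalSum (Sum.elim w w') (Sum.elim e e') = formalSum w e + formalSum w' e' := by
  ext n
  rw [map_add, coeff_formalSum_eq_sum w (s := (he n).toFinset) (by intro i hi; simp; omega),
    coeff_formalSum_eq_sum w' (s := (he' n).toFinset) (by intro i hi; simp; omega),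
    coeff_formalSum_eq_sum _ (s := (he n).toFinset.disjSum (he' n).toFinset)
      (by rintro (i | i) hi <;> simp at hi ⊢ <;> omega), sum_disjSum]
  rfl

/-- The derivation `X * d/dX`. -/
noncomputable def eulerDeriv (f : ℤ⟦X⟧) : ℤ⟦X⟧ := X * derivative ℤ f

theorem coeff_eulerDeriv (f : ℤ⟦X⟧) (n : ℕ) : coeff n (eulerDeriv f) = n * coeff n f := by
  cases n with
  | zero => simp [eulerDeriv]
  | succ n => rw [eulerDeriv, coeff_succ_X_mul, coeff_derivative]; push_cast; ring

theorem eulerDeriv_mul (f g : ℤ⟦X⟧) :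
    eulerDeriv (f * g) = eulerDeriv f * g + f * eulerDeriv g := by
  simp only [eulerDeriv, Derivation.leibniz, smul_eq_mul]
  ring

theorem eulerDeriv_formalSum {e : ι → ℕ} (he : FinFibers e) (w : ι → ℤ) :
    eulerDeriv (formalSum w e) = formalSum (fun i ↦ e i * w i) e := by
  ext n
  have hs : ∀ i, e i = n → i ∈ (he n).toFinset := by intro i hi; simp; omega
  rw [coeff_eulerDeriv, coeff_formalSum_eq_sum _ hs, coeff_formalSum_eq_sum _ hs, mul_sum]
  refine sum_congr rfl fun i _ ↦ ?_
  split_ifs with h <;> simp [h]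

end FormalSumLemmas

/-! ### Jacobi's series for the cube, and the sixth power of Euler's product. -/

section Dual

open DualNumber TrivSqZeroExt

/-- The unit `1 + ε`. -/
def oneAddEps : (DualNumber ℤ)ˣ where
  val := 1 + ε
  inv := 1 - ε
  val_inv := by ext <;> simp
  inv_val := by ext <;> simp

theorem neg_oneAddEps_zpow (m : ℤ) : (((-oneAddEps) ^ m : (DualNumber ℤ)ˣ) : DualNumber ℤ) =
    inl (m.negOnePow : ℤ) + inr ((m.negOnePow : ℤ) * m) := by
  have hinv : (((-oneAddEps)⁻¹ : (DualNumber ℤ)ˣ) : DualNumber ℤ) = -(1 - ε) := by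
    rw [inv_neg, Units.val_neg]; rfl
  induction m using Int.induction_on with
  | zero => simp
  | succ n ih =>
    rw [zpow_add_one, Units.val_mul, ih, Units.val_neg, Int.negOnePow_succ, Units.val_neg]
    generalize ((n : ℤ).negOnePow : ℤ) = s
    ext <;> (simp [oneAddEps]; try ring)
  | pred n ih =>
    rw [zpow_sub_one, Units.val_mul, ih, hinv, Int.negOnePow_sub, Int.negOnePow_one,
      Units.val_mul, Units.val_neg, Units.val_one]
    generalize ((-n : ℤ).negOnePow : ℤ) = s
    ext <;> (simp; try ring)

theorem finFibers_tri : FinFibers tri := fun n ↦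
  (Set.finite_Icc (-(n + 1 : ℤ)) n).subset fun m hm ↦ by
    simp only [Set.mem_ofPred_eq, Set.mem_Icc] at hm ⊢
    have := two_mul_tri m
    constructor <;> nlinarith

/-- **Jacobi's identity** for the cube of Euler's product. -/
theorem euler_cube :
    euler ^ 3 = formalSum (fun m : ℤ ↦ (m.negOnePow : ℤ) * (m + 1)) tri := by
  have h := (jacobi_triple_product oneAddEps (i := 0) (j := 1) (by norm_num)).comp
    (tendsto_add_atTop_nat 1)
  set a : DualNumber ℤ := (oneAddEps : DualNumber ℤ)
  set b : DualNumber ℤ := ((oneAddEps⁻¹ : (DualNumber ℤ)ˣ) : DualNumber ℤ)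
  have h1 := xLim_prod_one_sub a (u := fun n ↦ n + 1) fun n ↦ by omega
  have h2 := xLim_prod_one_sub b (u := fun n ↦ n + 1) fun n ↦ by omega
  have h3 := xLim_prod_one_sub (1 : DualNumber ℤ) (u := fun n ↦ n + 1) fun n ↦ by omega
  set A := iprod fun n ↦ 1 - C a * X ^ (n + 1)
  set B := iprod fun n ↦ 1 - C b * X ^ (n + 1)
  set D := iprod fun n ↦ 1 - C (1 : DualNumber ℤ) * X ^ (n + 1)
  have key : formalSum (fun m : ℤ ↦ (((-oneAddEps) ^ m : (DualNumber ℤ)ˣ) : DualNumber ℤ))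
      (tpExp 0 1) = C (-ε) * (A * B * D) := by
    refine h.unique ?_
    convert (xLim_const (C (-ε))).mul ((h1.mul (h2.comp (tendsto_add_atTop_nat 1))).mul
      (h3.comp (tendsto_add_atTop_nat 1))) using 2 with N
    rw [finTP, prod_mul_distrib, prod_range_succ', qFact]
    -- At α = 1 + ε the factor 1 - α is -ε, so the rest of the product matters only modulo ε, where
    -- it is the cube. The ε-part of the sum differentiates (-α)^m at α = 1.
    have : (1 - C (oneAddEps : DualNumber ℤ) : (DualNumber ℤ)⟦X⟧) = C (-ε) := by
      rw [← map_one C, ← map_sub]; rfl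
    simp only [zero_add, pow_zero, mul_one, this, pow_one, map_one, one_mul]
    simp only [← pow_succ', mul_assoc, a, b]
    exact mul_left_comm _ _ _
  have hX : (X : ℤ⟦X⟧) ∣ PowerSeries.map (fstHom ℤ ℤ ℤ).toRingHom X := by simp
  have hmap : ∀ c : DualNumber ℤ, c.fst = 1 →
      PowerSeries.map (fstHom ℤ ℤ ℤ).toRingHom (iprod fun n ↦ 1 - C c * X ^ (n + 1)) = euler := by
    intro c hc
    refine ((xLim_prod_one_sub c (u := fun n ↦ n + 1) fun n ↦ by omega).map _ hX).unique ?_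
    convert xLim_euler using 2 with N
    simp [map_prod, hc]
  have hA : PowerSeries.map (fstHom ℤ ℤ ℤ).toRingHom (A * B * D) = euler ^ 3 := by
    rw [map_mul, map_mul, hmap a (by simp [a, oneAddEps]), hmap b (by simp [b, oneAddEps]),
      hmap 1 (by simp)]
    ring
  have hshift := formalSum_comp_equiv (Equiv.addRight (1 : ℤ))
    (fun m : ℤ ↦ -((m.negOnePow : ℤ) * m)) (tpExp 0 1)
  have e1 : formalSum (fun m : ℤ ↦ (m.negOnePow : ℤ) * (m + 1)) tri =
      formalSum (fun m : ℤ ↦ -((m.negOnePow : ℤ) * m)) (tpExp 0 1) := by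
    rw [← hshift]
    congr 1 <;> ext m
    · simp [Int.negOnePow_succ]
    · simp [tpExp]
  rw [e1]
  ext n
  have e2 := map_coeff_formalSum (finFibers_tpExp (i := 0) (j := 1) (by norm_num))
    (-(sndHom ℤ ℤ).toAddMonoidHom)
    (fun m : ℤ ↦ (((-oneAddEps) ^ m : (DualNumber ℤ)ˣ) : DualNumber ℤ)) n
  rw [key, coeff_C_mul] at e2
  have e3 : ∀ w : DualNumber ℤ, (-(sndHom ℤ ℤ).toAddMonoidHom) (-ε * w) = w.fst := by
    intro w; simp
  have e4 : ∀ m : ℤ, (-(sndHom ℤ ℤ).toAddMonoidHom)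
      (((-oneAddEps) ^ m : (DualNumber ℤ)ˣ) : DualNumber ℤ) = -((m.negOnePow : ℤ) * m) := by
    intro m
    rw [neg_oneAddEps_zpow]
    generalize (m.negOnePow : ℤ) = s
    simp
  simp only [e4] at e2
  rw [← hA, PowerSeries.coeff_map, ← e2, e3]
  rfl

/-- Averaging over the symmetry m ↦ -1 - m of triangular numbers makes the weight 2m + 1, whose
square is 8 `tri` m + 1. -/
theorem two_mul_euler_cube :
    2 * euler ^ 3 = formalSum (fun m : ℤ ↦ (m.negOnePow : ℤ) * (2 * m + 1)) tri := by
  have h := formalSum_comp_equiv (Equiv.subLeft (-1 : ℤ))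
    (fun m : ℤ ↦ (m.negOnePow : ℤ) * (m + 1)) tri
  have h' : formalSum (fun m : ℤ ↦ (m.negOnePow : ℤ) * m) tri = euler ^ 3 := by
    rw [euler_cube, ← h]
    congr 1 <;> ext m
    · simp [Int.negOnePow_sub, Int.negOnePow_neg]
      ring
    · have h1 := two_mul_tri m
      have h2 := two_mul_tri (-1 - m)
      simp only [Equiv.subLeft_apply]
      zify
      linarith
  rw [two_mul]
  nth_rw 1 [← h']
  rw [euler_cube, ← formalSum_add finFibers_tri]
  congr 1
  ext m
  ring

/-- Rotation of `ℤ × ℤ` by a quarter of a right angle, with the two parity classes separated. -/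
def rotateEquiv : (ℤ × ℤ) ⊕ (ℤ × ℤ) ≃ ℤ × ℤ where
  toFun := Sum.elim (fun p ↦ (p.1 + p.2, p.1 - p.2)) (fun p ↦ (p.1 + p.2, p.2 - p.1 - 1))
  invFun q := if (q.1 + q.2) % 2 = 0 then .inl ((q.1 + q.2) / 2, (q.1 - q.2) / 2)
    else .inr ((q.1 - q.2 - 1) / 2, (q.1 + q.2 + 1) / 2)
  left_inv := by
    rintro (⟨r, s⟩ | ⟨r, s⟩)
    · refine (if_pos (by simp only [Sum.elim_inl]; omega)).trans ?_
      simp only [Sum.elim_inl, Sum.inl.injEq, Prod.mk.injEq]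
      omega
    · refine (if_neg (by simp only [Sum.elim_inr]; omega)).trans ?_
      simp only [Sum.elim_inr, Sum.inr.injEq, Prod.mk.injEq]
      omega
  right_inv := by
    rintro ⟨m, n⟩
    dsimp only
    split_ifs with h
    · simp only [Sum.elim_inl, Prod.mk.injEq]; omega
    · simp only [Sum.elim_inr, Prod.mk.injEq]; omega

theorem finFibers_two_mul_tri : FinFibers fun m : ℤ ↦ 2 * tri m := fun n ↦
  (finFibers_tri n).subset fun m hm ↦ by
    simp only [Set.mem_ofPred_eq] at hm ⊢
    omega

/-- Put a = r + s, b = r - s in the square of Jacobi's series: (2a + 1)(2b + 1) = (2r + 1)² - (2s)²,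
and the exponent is 2 `tri` r + s². The other parity class contributes equally, hence the factor 2.
As (2r + 1)² = 4(2 `tri` r) + 1 and (2s)² = 4s², the weights are affine in the exponents, which
brings in `eulerDeriv`. -/
theorem four_mul_euler_pow_six :
    4 * euler ^ 6 = 2 * (thetaPronic * thetaSq +
      4 * (eulerDeriv thetaPronic * thetaSq - thetaPronic * eulerDeriv thetaSq)) := by
  have hf := finFibers_two_mul_tri.prod finFibers_sq
  have h1 : 4 * euler ^ 6 = (2 * euler ^ 3) * (2 * euler ^ 3) := by ring
  have h2 : formalSum (fun p : ℤ × ℤ ↦ (2 * p.1 + 1) ^ 2 - (2 * p.2) ^ 2)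
      (fun p ↦ 2 * tri p.1 + p.2.natAbs ^ 2) = thetaPronic * thetaSq +
      4 * (eulerDeriv thetaPronic * thetaSq - thetaPronic * eulerDeriv thetaSq) := by
    rw [thetaPronic, thetaSq, eulerDeriv_formalSum finFibers_two_mul_tri,
      eulerDeriv_formalSum finFibers_sq, formalSum_mul finFibers_two_mul_tri finFibers_sq,
      formalSum_mul finFibers_two_mul_tri finFibers_sq,
      formalSum_mul finFibers_two_mul_tri finFibers_sq, ← formalSum_sub hf]
    ext n
    have hs : ∀ p : ℤ × ℤ, 2 * tri p.1 + p.2.natAbs ^ 2 = n → p ∈ (hf n).toFinset := by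
      intro p hp; simp; omega
    rw [map_add, show (4 : ℤ⟦X⟧) = C 4 from rfl, coeff_C_mul, coeff_formalSum_eq_sum _ hs,
      coeff_formalSum_eq_sum _ hs, coeff_formalSum_eq_sum _ hs, mul_sum, ← sum_add_distrib]
    refine sum_congr rfl fun p _ ↦ ?_
    have := two_mul_tri p.1
    split_ifs
    · push_cast
      rw [sq_abs]
      linear_combination (-4) * this
    · simp
  rw [h1, two_mul_euler_cube, formalSum_mul finFibers_tri finFibers_tri,
    ← formalSum_comp_equiv rotateEquiv, ← h2, two_mul, ← formalSum_sumElim hf hf]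
  congr 1
  · ext (⟨r, s⟩ | ⟨r, s⟩)
    · simp only [rotateEquiv, Equiv.coe_fn_mk, Sum.elim_inl]
      have : ((r - s).negOnePow : ℤ) = ((r + s).negOnePow : ℤ) := by
        rw [Int.negOnePow_sub, Int.negOnePow_add]
      rw [this]
      have h2 : ((r + s).negOnePow : ℤ) * ((r + s).negOnePow : ℤ) = 1 := by
        rw [← Units.val_mul, Int.units_mul_self, Units.val_one]
      linear_combination ((2 * r + 1) ^ 2 - (2 * s) ^ 2) * h2
    · simp only [rotateEquiv, Equiv.coe_fn_mk, Sum.elim_inr]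
      have : ((s - r - 1).negOnePow : ℤ) = -((r + s).negOnePow : ℤ) := by
        rw [Int.negOnePow_sub, Int.negOnePow_sub, Int.negOnePow_add, Int.negOnePow_one]
        push_cast
        ring
      rw [this]
      have h2 : ((r + s).negOnePow : ℤ) * ((r + s).negOnePow : ℤ) = 1 := by
        rw [← Units.val_mul, Int.units_mul_self, Units.val_one]
      linear_combination ((2 * r + 1) ^ 2 - (2 * s) ^ 2) * h2
  · ext (⟨r, s⟩ | ⟨r, s⟩)
    · simp only [rotateEquiv, Equiv.coe_fn_mk, Sum.elim_inl]
      have a1 := two_mul_tri (r + s)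
      have a2 := two_mul_tri (r - s)
      have a3 := two_mul_tri r
      zify
      rw [sq_abs]
      linarith
    · simp only [rotateEquiv, Equiv.coe_fn_mk, Sum.elim_inr]
      have a1 := two_mul_tri (r + s)
      have a2 := two_mul_tri (s - r - 1)
      have a3 := two_mul_tri r
      zify
      rw [sq_abs]
      linarith

end Dual
end QSeries

namespace QSeries
open PowerSeries Filter Finset

/-! ### The generating function of `DSOME`. -/

section GeneratingFunction

open DualNumber TrivSqZeroExt
open scoped PowerSeries.WithPiTopology

theorem xLim_genFun {K : Type*} [CommRing K] {f : ℕ → ℕ → K} (hf : ∀ i c, 2 ≤ c → f i c = 0) :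
    XLim (fun N ↦ ∏ i ∈ range N, (1 + C (f (i + 1) 1) * X ^ (i + 1)))
      (Nat.Partition.genFun f) := by
  -- With discrete coefficients, convergence of a series means that each coefficient is eventually
  -- constant, which is `XLim`.
  let : TopologicalSpace K := ⊥
  have : DiscreteTopology K := ⟨rfl⟩
  have h := (Nat.Partition.hasProd_genFun f).comp tendsto_finset_range
  rw [WithPiTopology.tendsto_iff_coeff_tendsto] at h
  have hterm : ∀ i : ℕ, (1 : K⟦X⟧) + ∑' j, f (i + 1) (j + 1) • X ^ ((i + 1) * (j + 1)) =
      1 + C (f (i + 1) 1) * X ^ (i + 1) := by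
    intro i
    rw [tsum_eq_single 0]
    · simp [smul_eq_C_mul]
    · intro j hj
      rw [hf _ _ (by omega), zero_smul]
  simp only [hterm, Function.comp_def, nhds_discrete, tendsto_pure] at h
  intro d
  have := (eventually_all_finset (range d)).2 fun n _ ↦ h n
  filter_upwards [this] with N hN
  rw [X_pow_dvd_iff]
  intro m hm
  rw [map_sub, hN m (mem_range.2 hm), sub_self]

/-- The part `k` with the sign it carries in `DSOME`. -/
def signedPart (k : ℕ) : ℤ := if Odd k then k else -k

theorem prod_one_add_mul_eps (s : Finset ℕ) (w : ℕ → ℤ) :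
    ∏ i ∈ s, (1 + inr (w i) : DualNumber ℤ) = 1 + inr (∑ i ∈ s, w i) := by
  classical
  induction s using Finset.induction_on with
  | empty => simp
  | insert a s ha ih =>
    rw [prod_insert ha, sum_insert ha, ih]
    ext <;> simp
    ring

theorem dsome_eq_sum (n : ℕ) :
    DSOME n = ∑ p ∈ Nat.Partition.distincts n, ∑ k ∈ p.parts.toFinset, signedPart k := by
  rw [DSOME, ← sum_sub_distrib]
  refine sum_congr rfl fun p hp ↦ ?_
  have hnd : p.parts.Nodup := by simpa [Nat.Partition.distincts] using hp
  have h1 : ∀ (q : ℕ → Prop) [DecidablePred q], ((p.parts.filter q).sum : ℤ) =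
      ∑ k ∈ p.parts.toFinset, if q k then (k : ℤ) else 0 := by
    intro q _
    rw [← sum_filter]
    have : (p.parts.filter q).sum = ∑ k ∈ p.parts.toFinset with q k, k := by
      rw [Finset.sum, Multiset.map_id']
      congr 1
      rw [Finset.filter_val, Multiset.toFinset_val, hnd.dedup]
    rw [this]
    push_cast
    rfl
  rw [h1, h1, ← sum_sub_distrib]
  refine sum_congr rfl fun k _ ↦ ?_
  rcases Nat.even_or_odd k with h | h
  · simp [signedPart, h, Nat.not_odd_iff_even.2 h]
  · simp [signedPart, h, Nat.not_even_iff_odd.2 h]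

/-- The weight function marking the signed sum of the parts of a partition into distinct parts. -/
def dsomeWeight (i c : ℕ) : DualNumber ℤ := if c = 1 then 1 + inr (signedPart i) else 0

/-- Repeated parts have weight zero, and the ε-part of a product of factors 1 + s_k ε is the sum of
the s_k. -/
theorem snd_coeff_genFun_dsomeWeight (n : ℕ) :
    (coeff n (Nat.Partition.genFun dsomeWeight)).snd = DSOME n := by
  have h1 : ∀ p : n.Partition, p.parts.toFinsupp.prod dsomeWeight =
      if p ∈ Nat.Partition.distincts n then 1 + inr (∑ k ∈ p.parts.toFinset, signedPart k)
      else 0 := by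
    intro p
    rw [Finsupp.prod, Multiset.toFinsupp_support]
    split_ifs with h
    · have hnd : p.parts.Nodup := by simpa [Nat.Partition.distincts] using h
      rw [← prod_one_add_mul_eps]
      refine prod_congr rfl fun k hk ↦ ?_
      rw [Multiset.mem_toFinset] at hk
      rw [Multiset.toFinsupp_apply, Multiset.count_eq_one_of_mem hnd hk, dsomeWeight, if_pos rfl]
    · have hnd : ¬p.parts.Nodup := by simpa [Nat.Partition.distincts] using h
      rw [Multiset.nodup_iff_count_eq_one] at hnd
      push Not at hnd
      obtain ⟨k, hk, hk'⟩ := hnd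
      refine prod_eq_zero (Multiset.mem_toFinset.2 hk) ?_
      rw [Multiset.toFinsupp_apply, dsomeWeight, if_neg hk']
  rw [Nat.Partition.coeff_genFun, sum_congr rfl fun p _ ↦ h1 p, ← sum_filter, dsome_eq_sum,
    snd_sum]
  simp only [snd_add, snd_one, snd_inr, zero_add]
  rw [filter_univ_mem]

theorem oneAddEps_pow (n : ℕ) : ((oneAddEps : DualNumber ℤ)) ^ n = 1 + inr (n : ℤ) := by
  induction n with
  | zero => simp
  | succ n ih =>
    rw [pow_succ, ih]
    ext <;> simp [oneAddEps]
    ring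

theorem oneAddEps_inv_pow (n : ℕ) :
    (((oneAddEps⁻¹ : (DualNumber ℤ)ˣ) : DualNumber ℤ)) ^ n = 1 + inr (-n : ℤ) := by
  have h : ((oneAddEps⁻¹ : (DualNumber ℤ)ˣ) : DualNumber ℤ) = 1 - ε := rfl
  induction n with
  | zero => simp
  | succ n ih =>
    rw [pow_succ, ih, h]
    ext <;> simp

/-- The generating function of `DSOME` by logarithmic differentiation. -/
theorem mk_dsome : (.mk DSOME : ℤ⟦X⟧) = eulerDeriv oddDistinctSeries * evenDistinctSeries -
    oddDistinctSeries * eulerDeriv evenDistinctSeries := by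
  set a : DualNumber ℤ := (oneAddEps : DualNumber ℤ) with ha
  set b : DualNumber ℤ := ((oneAddEps⁻¹ : (DualNumber ℤ)ˣ) : DualNumber ℤ) with hb
  let ι : ℤ⟦X⟧ →+* (DualNumber ℤ)⟦X⟧ := PowerSeries.map (Int.castRingHom (DualNumber ℤ))
  have hX : ∀ c : DualNumber ℤ, (X : (DualNumber ℤ)⟦X⟧) ∣ ((rescale c).comp ι) X := by
    intro c
    simp [ι]
  have hO := xLim_oddDistinctSeries.map _ (hX a)
  have hE := xLim_evenDistinctSeries.map _ (hX b)
  -- Since (1 + ε)^k = 1 + kε, the signed weights amount to the substitutions X ↦ (1 + ε)X on odd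
  -- parts and X ↦ (1 + ε)⁻¹X on even parts.
  have key : Nat.Partition.genFun dsomeWeight =
      rescale a (ι oddDistinctSeries) * rescale b (ι evenDistinctSeries) := by
    refine ((xLim_genFun (f := dsomeWeight) ?_).comp
      (tendsto_mul_atTop' (k := 2) (by norm_num))).unique ?_
    · intro i c hc
      rw [dsomeWeight, if_neg (by omega)]
    · change XLim _ ((rescale a).comp ι oddDistinctSeries * (rescale b).comp ι evenDistinctSeries)
      convert hO.mul hE using 2 with N
      rw [map_prod, map_prod, ← prod_mul_distrib, prod_range_mul_left]
      refine prod_congr rfl fun n _ ↦ ?_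
      rw [prod_range_succ, prod_range_one]
      congr 1
      · simp only [RingHom.coe_comp, Function.comp_apply, map_add, map_one, map_pow, ι,
          PowerSeries.map_X, rescale_X, mul_pow, ← map_pow C, ha, oneAddEps_pow]
        rw [dsomeWeight, if_pos rfl, signedPart, if_pos (by simp)]
        simp
      · simp only [RingHom.coe_comp, Function.comp_apply, map_add, map_one, map_pow, ι,
          PowerSeries.map_X, rescale_X, mul_pow, ← map_pow C, hb, oneAddEps_inv_pow]
        rw [dsomeWeight, if_pos rfl, signedPart, if_neg (by simp [Nat.even_add_one])]
        simp [add_assoc]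
  ext n
  rw [coeff_mk, ← snd_coeff_genFun_dsomeWeight, key, coeff_mul, snd_sum, map_sub, coeff_mul,
    coeff_mul, ← sum_sub_distrib]
  refine sum_congr rfl fun p _ ↦ ?_
  rw [coeff_rescale, coeff_rescale, coeff_eulerDeriv, coeff_eulerDeriv, ha, hb, oneAddEps_pow,
    oneAddEps_inv_pow]
  simp only [ι, PowerSeries.coeff_map]
  simp
  ring

/-- Inserting the product forms of both theta series turns their Wronskian into that of the odd and
even products, giving E⁶ = D E(q²)² (D - 8G). Then E(q²) = DE and Dφ = E, and a common factor D³E²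
cancels. -/
theorem eight_mul_mk_dsome :
    8 * (.mk DSOME : ℤ⟦X⟧) = distinctSeries - euler * phi ^ 3 := by
  set G : ℤ⟦X⟧ := .mk DSOME with hG
  have hc : coeff 0 distinctSeries = 1 := by simp [distinctSeries, iprod]
  have hD : distinctSeries ≠ 0 := by
    intro h
    rw [h] at hc
    simp at hc
  have hcE : coeff 0 euler = 1 := by simp [euler, iprod]
  have hE : euler ≠ 0 := by
    intro h
    rw [h] at hcE
    simp at hcE
  have h1 := mk_dsome
  have h2 := four_mul_euler_pow_six
  have h3 := oddDistinctSeries_mul_evenDistinctSeries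
  have h4 := distinctSeries_mul_euler
  have h5 := distinctSeries_mul_phi
  have hconst : eulerDeriv (2 : ℤ⟦X⟧) = 0 := by
    rw [show (2 : ℤ⟦X⟧) = C 2 from rfl, eulerDeriv, derivative_C, mul_zero]
  rw [← hG] at h1
  rw [thetaPronic_eq, thetaSq_eq] at h2
  simp only [sq, eulerDeriv_mul, hconst] at h2
  set O := oddDistinctSeries
  set V := evenDistinctSeries
  set D := distinctSeries
  set e := dil 2 euler
  have h6 : euler ^ 6 = D * e ^ 2 * (D - 8 * G) := by
    have : (4 : ℤ⟦X⟧) ≠ 0 := fun h ↦ by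
      have := congrArg (coeff 0) h
      rw [show (4 : ℤ⟦X⟧) = C 4 from rfl, coeff_zero_C, map_zero] at this
      norm_num at this
    apply mul_left_cancel₀ this
    rw [h1, ← h3]
    linear_combination h2
  have h7 : (D ^ 3 * euler ^ 2) * (8 * G) = (D ^ 3 * euler ^ 2) * (D - euler * phi ^ 3) := by
    rw [← h4] at h6
    linear_combination h6 - (-(euler ^ 3 * (euler ^ 2 + euler * (D * phi) + (D * phi) ^ 2))) * h5
  exact mul_left_cancel₀ (mul_ne_zero (pow_ne_zero _ hD) (pow_ne_zero _ hE)) h7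

end GeneratingFunction
end QSeries

namespace QSeries
open PowerSeries Filter Finset

/-! ### Sections modulo five. -/

section Sections

/-- The series whose coefficients are those of `f` in the residue class of `r` modulo five. -/
noncomputable def sect (r : ℕ) (f : ℤ⟦X⟧) : ℤ⟦X⟧ := .mk fun n ↦ coeff (5 * n + r) f

theorem coeff_sect (r : ℕ) (f : ℤ⟦X⟧) (n : ℕ) : coeff n (sect r f) = coeff (5 * n + r) f :=
  coeff_mk _ _

theorem sect_add (r : ℕ) (f g : ℤ⟦X⟧) : sect r (f + g) = sect r f + sect r g := by
  ext n; simp [coeff_sect]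

theorem sect_sub (r : ℕ) (f g : ℤ⟦X⟧) : sect r (f - g) = sect r f - sect r g := by
  ext n; simp [coeff_sect]

theorem sect_C_mul (r : ℕ) (c : ℤ) (f : ℤ⟦X⟧) : sect r (C c * f) = C c * sect r f := by
  ext n; rw [coeff_sect, coeff_C_mul, coeff_C_mul, coeff_sect]

/-- The series with prescribed sections modulo five. -/
noncomputable def ofSects (c₀ c₁ c₂ c₃ c₄ : ℤ⟦X⟧) : ℤ⟦X⟧ :=
  dil 5 c₀ + X * dil 5 c₁ + X ^ 2 * dil 5 c₂ + X ^ 3 * dil 5 c₃ + X ^ 4 * dil 5 c₄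

theorem sect_X_pow_mul_dil {r j : ℕ} (hr : r < 5) (hj : j < 5) (g : ℤ⟦X⟧) :
    sect r (X ^ j * dil 5 g) = if r = j then g else 0 := by
  ext n
  rw [coeff_sect, coeff_X_pow_mul', coeff_dil]
  split_ifs with h1 h2 h3 h4 h5
  · congr 2; omega
  · omega
  · omega
  · simp
  · omega
  · simp

theorem sect_ofSects {r : ℕ} (hr : r < 5) (c₀ c₁ c₂ c₃ c₄ : ℤ⟦X⟧) :
    sect r (ofSects c₀ c₁ c₂ c₃ c₄) = (if r = 0 then c₀ else 0) + (if r = 1 then c₁ else 0) +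
      (if r = 2 then c₂ else 0) + (if r = 3 then c₃ else 0) + (if r = 4 then c₄ else 0) := by
  rw [ofSects, ← one_mul (dil 5 c₀), ← pow_zero (X : ℤ⟦X⟧)]
  conv_lhs => rw [← pow_one (X : ℤ⟦X⟧)]
  simp only [sect_add, pow_one]
  rw [← pow_one (X : ℤ⟦X⟧)]
  simp only [← pow_mul, one_mul, mul_zero]
  rw [sect_X_pow_mul_dil hr (by norm_num), sect_X_pow_mul_dil hr (by norm_num),
    sect_X_pow_mul_dil hr (by norm_num), sect_X_pow_mul_dil hr (by norm_num),
    sect_X_pow_mul_dil hr (by norm_num)]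

theorem ofSects_sect (f : ℤ⟦X⟧) :
    ofSects (sect 0 f) (sect 1 f) (sect 2 f) (sect 3 f) (sect 4 f) = f := by
  ext n
  have h := congrArg (coeff (n / 5)) (sect_ofSects (r := n % 5) (Nat.mod_lt _ (by norm_num))
    (sect 0 f) (sect 1 f) (sect 2 f) (sect 3 f) (sect 4 f))
  rw [coeff_sect, Nat.div_add_mod] at h
  rw [h]
  have hn : n % 5 < 5 := Nat.mod_lt _ (by norm_num)
  have hd := Nat.div_add_mod n 5
  generalize n % 5 = r at *
  interval_cases r <;> simp [coeff_sect] <;> congr 2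

theorem ofSects_mul (a₀ a₁ a₂ a₃ a₄ b₀ b₁ b₂ b₃ b₄ : ℤ⟦X⟧) :
    ofSects a₀ a₁ a₂ a₃ a₄ * ofSects b₀ b₁ b₂ b₃ b₄ = ofSects
      (a₀ * b₀ + X * (a₁ * b₄ + a₂ * b₃ + a₃ * b₂ + a₄ * b₁))
      (a₀ * b₁ + a₁ * b₀ + X * (a₂ * b₄ + a₃ * b₃ + a₄ * b₂))
      (a₀ * b₂ + a₁ * b₁ + a₂ * b₀ + X * (a₃ * b₄ + a₄ * b₃))
      (a₀ * b₃ + a₁ * b₂ + a₂ * b₁ + a₃ * b₀ + X * (a₄ * b₄))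
      (a₀ * b₄ + a₁ * b₃ + a₂ * b₂ + a₃ * b₁ + a₄ * b₀) := by
  simp only [ofSects, map_add, map_mul, dil_X]
  ring

variable {ι κ : Type*}

theorem formalSum_const_mul {e : ι → ℕ} (he : FinFibers e) (c : ℤ) (w : ι → ℤ) :
    formalSum (fun i ↦ c * w i) e = C c * formalSum w e := by
  ext n
  rw [coeff_C_mul]
  exact (map_coeff_formalSum he (AddMonoidHom.mulLeft c) w n).symm

theorem dil_formalSum (k : ℕ) [NeZero k] (w : ι → ℤ) (e : ι → ℕ) :
    dil k (formalSum w e) = formalSum w fun i ↦ k * e i := by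
  ext n
  have hk : 0 < k := Nat.pos_of_ne_zero (NeZero.ne k)
  rw [coeff_dil, coeff_formalSum, coeff_formalSum]
  split_ifs with h
  · obtain ⟨d, rfl⟩ := h
    rw [Nat.mul_div_cancel_left _ hk]
    refine finsum_congr fun i ↦ ?_
    rw [show k * e i = k * d ↔ e i = d from Nat.mul_right_inj hk.ne'] 
  · refine (finsum_eq_zero_of_forall_eq_zero fun i ↦ ?_).symm
    have : ¬k * e i = n := fun h' ↦ h ⟨_, h'.symm⟩
    simp [this]

theorem sect_formalSum {r : ℕ} {w : ι → ℤ} {e : ι → ℕ} {w' : κ → ℤ} {e' : κ → ℕ} (σ : κ → ι)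
    (hσ : Function.Injective σ) (hr : ∀ i n, e i = 5 * n + r → i ∈ Set.range σ)
    (he : ∀ k, e (σ k) = 5 * e' k + r) (hw : ∀ k, w (σ k) = w' k) :
    sect r (formalSum w e) = formalSum w' e' := by
  ext n
  rw [coeff_sect, coeff_formalSum, coeff_formalSum]
  refine (finsum_mem_eq_of_bijOn (s := {k | e' k = n}) (t := {i | e i = 5 * n + r}) σ
    ⟨?_, hσ.injOn, ?_⟩ fun k _ ↦ (hw k).symm).symm
  · intro k hk
    simp only [Set.mem_ofPred_eq] at hk ⊢
    rw [he, hk]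
  · intro i hi
    simp only [Set.mem_ofPred_eq] at hi
    obtain ⟨k, rfl⟩ := hr i n hi
    refine ⟨k, ?_, rfl⟩
    simp only [Set.mem_ofPred_eq]
    have := he k
    omega

theorem sect_formalSum_eq_zero {r : ℕ} {w : ι → ℤ} {e : ι → ℕ}
    (hr : ∀ i n, e i ≠ 5 * n + r) : sect r (formalSum w e) = 0 := by
  ext n
  rw [coeff_sect, coeff_formalSum, map_zero]
  exact finsum_eq_zero_of_forall_eq_zero fun i ↦ by simp [hr i n]

end Sections

/-! ### The 5-dissections of E, φ and E(q²). -/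

section Dissections

theorem two_mul_tpExp (i j : ℕ) (m : ℤ) :
    2 * (tpExp i j m : ℤ) = i * (m * (m + 1)) + j * (m * (m - 1)) := by
  have h1 := two_mul_tri m
  have h2 := tri_sub_one m
  simp only [tpExp, Nat.cast_add, Nat.cast_mul, h2]
  linear_combination (i + j : ℤ) * h1

theorem tpExp_one_two_mod {m : ℤ} {n r : ℕ} (h : tpExp 1 2 m = 5 * n + r) :
    (m : ZMod 5) * (3 * m - 1) = 2 * r := by
  have h1 := two_mul_tpExp 1 2 m
  rw [h] at h1
  have h2 := congrArg (Int.cast : ℤ → ZMod 5) h1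
  push_cast at h2
  have h5 : (5 : ZMod 5) = 0 := rfl
  linear_combination 2 * n * h5 - h2

theorem sq_mod {m : ℤ} {n r : ℕ} (h : m.natAbs ^ 2 = 5 * n + r) : (m : ZMod 5) ^ 2 = r := by
  zify at h
  rw [sq_abs] at h
  have h2 := congrArg (Int.cast : ℤ → ZMod 5) h
  push_cast at h2
  have h5 : (5 : ZMod 5) = 0 := rfl
  linear_combination n * h5 + h2

theorem exists_five_mul_add {m : ℤ} (r : ℤ) (h : (m : ZMod 5) = r) : ∃ k : ℤ, m = 5 * k + r := by
  have := (ZMod.intCast_eq_intCast_iff_dvd_sub r m 5).1 h.symm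
  obtain ⟨k, hk⟩ := this
  exact ⟨k, by push_cast at hk; linarith⟩

theorem negOnePow_five_mul (k : ℤ) : (5 * k).negOnePow = k.negOnePow := by
  rw [show 5 * k = k + 2 * (2 * k) by ring, Int.negOnePow_add, Int.negOnePow_two_mul, mul_one]

theorem sect_one_euler : sect 1 euler = -dil 5 euler := by
  have h := formalSum_const_mul (finFibers_tpExp (i := 1) (j := 2) (by norm_num)) (-1)
    fun m : ℤ ↦ (m.negOnePow : ℤ)
  have h' : -dil 5 euler = dil 5 (C (-1) * euler) := by rw [map_neg C, map_one]; simp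
  rw [h']
  nth_rw 2 [euler_eq_formalSum]
  rw [← h, dil_formalSum, euler_eq_formalSum]
  -- The pentagonal number of index 1 - 5k is 1 + 25 times that of index k; the minus sign before k
  -- makes the exponents agree.
  refine sect_formalSum (fun k : ℤ ↦ 5 * (-k) + 1) (fun a b h ↦ by dsimp only at h; omega) ?_ ?_ ?_
  · intro m n hm
    have h1 := tpExp_one_two_mod hm
    have h2 : (m : ZMod 5) = (1 : ℤ) := by
      push_cast at h1 ⊢
      generalize (m : ZMod 5) = x at h1
      revert x; decide
    obtain ⟨k, hk⟩ := exists_five_mul_add 1 h2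
    exact ⟨-k, by simp [hk]⟩
  · intro k
    have h1 := two_mul_tpExp 1 2 k
    have h2 := two_mul_tpExp 1 2 (5 * (-k) + 1)
    zify
    push_cast at h1 h2
    linarith
  · intro k
    rw [Int.negOnePow_succ, negOnePow_five_mul, Int.negOnePow_neg]
    simp

theorem sect_three_euler : sect 3 euler = 0 := by
  rw [euler_eq_formalSum]
  refine sect_formalSum_eq_zero fun m n hm ↦ ?_
  have h1 := tpExp_one_two_mod hm
  generalize (m : ZMod 5) = x at h1
  revert x; decide

theorem sect_four_euler : sect 4 euler = 0 := by
  rw [euler_eq_formalSum]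
  refine sect_formalSum_eq_zero fun m n hm ↦ ?_
  have h1 := tpExp_one_two_mod hm
  generalize (m : ZMod 5) = x at h1
  revert x; decide

theorem euler_eq_ofSects :
    euler = ofSects (sect 0 euler) (-dil 5 euler) (sect 2 euler) 0 0 := by
  conv_lhs => rw [← ofSects_sect euler, sect_one_euler, sect_three_euler, sect_four_euler]

theorem sect_zero_phi : sect 0 phi = dil 5 phi := by
  rw [phi, dil_formalSum]
  refine sect_formalSum (fun k : ℤ ↦ 5 * k) (fun a b h ↦ by dsimp only at h; omega) ?_ ?_ ?_
  · intro m n hm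
    have h1 := sq_mod hm
    have h2 : (m : ZMod 5) = (0 : ℤ) := by
      push_cast at h1 ⊢
      generalize (m : ZMod 5) = x at h1
      revert x; decide
    obtain ⟨k, hk⟩ := exists_five_mul_add 0 h2
    exact ⟨k, by simp [hk]⟩
  · intro k
    rw [Int.natAbs_mul]
    simp
    ring
  · intro k
    rw [negOnePow_five_mul]

theorem sect_two_phi : sect 2 phi = 0 := by
  refine sect_formalSum_eq_zero fun m n hm ↦ ?_
  have h1 := sq_mod hm
  generalize (m : ZMod 5) = x at h1
  revert x; decide

theorem sect_three_phi : sect 3 phi = 0 := by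
  refine sect_formalSum_eq_zero fun m n hm ↦ ?_
  have h1 := sq_mod hm
  generalize (m : ZMod 5) = x at h1
  revert x; decide

theorem sect_one_phi : sect 1 phi = -(2 * phiOne) := by
  have hf := finFibers_tpExp (i := 7) (j := 3) (by norm_num)
  have h := formalSum_const_mul hf (-1) fun m : ℤ ↦ (m.negOnePow : ℤ)
  have h' : -(2 * phiOne) = C (-1) * phiOne + C (-1) * phiOne := by
    rw [map_neg C, map_one]; ring
  rw [h']
  unfold phiOne
  rw [← h, ← formalSum_sumElim hf hf]
  -- Squares congruent to 1 mod 5 come from m ≡ ±1, giving two copies of `phiOne`; both signs are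
  -- reversed because 5k + 1 and k have opposite parity.
  refine sect_formalSum (Sum.elim (fun k : ℤ ↦ 5 * k + 1) (fun k ↦ -(5 * k + 1))) ?_ ?_ ?_ ?_
  · rintro (a | a) (b | b) h <;> simp only [Sum.elim_inl, Sum.elim_inr] at h
    · congr 1; omega
    · omega
    · omega
    · congr 1; omega
  · intro m n hm
    have h1 := sq_mod hm
    have h2 : (m : ZMod 5) = (1 : ℤ) ∨ ((-m : ℤ) : ZMod 5) = (1 : ℤ) := by
      push_cast at h1 ⊢
      generalize (m : ZMod 5) = x at h1
      revert x; decide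
    rcases h2 with h2 | h2
    · obtain ⟨k, hk⟩ := exists_five_mul_add 1 h2
      exact ⟨.inl k, by simp [hk]⟩
    · obtain ⟨k, hk⟩ := exists_five_mul_add 1 h2
      exact ⟨.inr k, by simp only [Sum.elim_inr]; omega⟩
  · rintro (k | k)
    all_goals
      simp only [Sum.elim_inl, Sum.elim_inr, Int.natAbs_neg]
      have h1 := two_mul_tpExp 7 3 k
      zify
      rw [sq_abs]
      push_cast at h1
      linarith
  · rintro (k | k) <;>
      simp only [Sum.elim_inl, Sum.elim_inr, Int.negOnePow_neg, Int.negOnePow_succ,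
        negOnePow_five_mul, Units.val_neg, neg_one_mul]

theorem sect_four_phi : sect 4 phi = 2 * phiFour := by
  have hf := finFibers_tpExp (i := 9) (j := 1) (by norm_num)
  rw [two_mul]
  unfold phiFour
  rw [← formalSum_sumElim hf hf]
  refine sect_formalSum (Sum.elim (fun k : ℤ ↦ 5 * k + 2) (fun k ↦ -(5 * k + 2))) ?_ ?_ ?_ ?_
  · rintro (a | a) (b | b) h <;> simp only [Sum.elim_inl, Sum.elim_inr] at h
    · congr 1; omega
    · omega
    · omega
    · congr 1; omega
  · intro m n hm
    have h1 := sq_mod hm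
    have h2 : (m : ZMod 5) = (2 : ℤ) ∨ ((-m : ℤ) : ZMod 5) = (2 : ℤ) := by
      push_cast at h1 ⊢
      generalize (m : ZMod 5) = x at h1
      revert x; decide
    rcases h2 with h2 | h2
    · obtain ⟨k, hk⟩ := exists_five_mul_add 2 h2
      exact ⟨.inl k, by simp [hk]⟩
    · obtain ⟨k, hk⟩ := exists_five_mul_add 2 h2
      exact ⟨.inr k, by simp only [Sum.elim_inr]; omega⟩
  · rintro (k | k)
    all_goals
      simp only [Sum.elim_inl, Sum.elim_inr, Int.natAbs_neg]
      have h1 := two_mul_tpExp 9 1 k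
      zify
      rw [sq_abs]
      push_cast at h1
      linarith
  · have h2 : (2 : ℤ).negOnePow = 1 := Int.negOnePow_even 2 even_two
    rintro (k | k) <;>
      simp only [Sum.elim_inl, Sum.elim_inr, Int.negOnePow_neg, Int.negOnePow_add,
        negOnePow_five_mul, h2, mul_one]

theorem phi_eq_ofSects : phi = ofSects (dil 5 phi) (-(2 * phiOne)) 0 0 (2 * phiFour) := by
  conv_lhs => rw [← ofSects_sect phi, sect_zero_phi, sect_one_phi, sect_two_phi, sect_three_phi,
    sect_four_phi]

theorem dil_two_dil_five (f : ℤ⟦X⟧) : dil 2 (dil 5 f) = dil 5 (dil 2 f) := by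
  rw [← dil_ten]
  exact (PowerSeries.expand_mul 2 (by norm_num) 5 (by norm_num) f).symm

theorem dil_two_euler_eq_ofSects : dil 2 euler =
    ofSects (dil 2 (sect 0 euler)) 0 (-dil 2 (dil 5 euler)) 0 (dil 2 (sect 2 euler)) := by
  conv_lhs => rw [euler_eq_ofSects]
  simp only [ofSects, map_add, map_mul, map_pow, dil_X, map_zero, map_neg, dil_two_dil_five]
  ring

end Dissections
end QSeries

namespace QSeries
open PowerSeries Filter Finset

/-! ### Hecke operators at five, through Gaussian integers. -/

section Gaussian

/-- The lattice points on a circle. -/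
def circle (n : ℤ) : Set (ℤ × ℤ) := {p | p.1 ^ 2 + p.2 ^ 2 = n}

theorem finite_circle (n : ℤ) : (circle n).Finite := by
  refine ((Set.finite_Icc (-n) n).prod (Set.finite_Icc (-n) n)).subset fun p hp ↦ ?_
  have hp : p.1 ^ 2 + p.2 ^ 2 = n := hp
  simp only [Set.mem_prod, Set.mem_Icc]
  have h1 : |p.1| ≤ p.1 ^ 2 := by rw [← sq_abs]; exact Int.le_self_sq _
  have h2 : |p.2| ≤ p.2 ^ 2 := by rw [← sq_abs]; exact Int.le_self_sq _
  have h3 := abs_le.1 (show |p.1| ≤ n by nlinarith [sq_nonneg p.2])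
  have h4 := abs_le.1 (show |p.2| ≤ n by nlinarith [sq_nonneg p.1])
  exact ⟨h3, h4⟩

/-- Gaussian integers of norm `5 * n` are the multiples of `2 + i` or `2 - i`. -/
theorem finsum_circle_five_mul (w : ℤ × ℤ → ℤ) (n : ℤ) :
    ∑ᶠ p ∈ circle (5 * n), w p + ∑ᶠ p ∈ {p : ℤ × ℤ | 5 * (p.1 ^ 2 + p.2 ^ 2) = n},
      w (5 * p.1, 5 * p.2) =
    ∑ᶠ p ∈ circle n, (w (2 * p.1 - p.2, p.1 + 2 * p.2) +
      w (2 * p.1 + p.2, -p.1 + 2 * p.2)) := by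
  let f : ℤ × ℤ → ℤ × ℤ := fun p ↦ (2 * p.1 - p.2, p.1 + 2 * p.2)
  let g : ℤ × ℤ → ℤ × ℤ := fun p ↦ (2 * p.1 + p.2, -p.1 + 2 * p.2)
  let h : ℤ × ℤ → ℤ × ℤ := fun p ↦ (5 * p.1, 5 * p.2)
  have hf : Function.Injective f := fun p q hpq ↦ by
    simp only [f, Prod.mk.injEq] at hpq; ext <;> omega
  have hg : Function.Injective g := fun p q hpq ↦ by
    simp only [g, Prod.mk.injEq] at hpq; ext <;> omega
  have hh : Function.Injective h := fun p q hpq ↦ by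
    simp only [h, Prod.mk.injEq] at hpq; ext <;> omega
  have hU : f '' circle n ∪ g '' circle n = circle (5 * n) := by
    ext ⟨a, b⟩
    constructor
    · rintro (⟨⟨x, y⟩, hp, hq⟩ | ⟨⟨x, y⟩, hp, hq⟩) <;>
      · have hp : x ^ 2 + y ^ 2 = n := hp
        simp only [f, g, Prod.mk.injEq] at hq
        obtain ⟨rfl, rfl⟩ := hq
        change _ ^ 2 + _ ^ 2 = 5 * n
        rw [← hp]
        ring
    · intro hp
      have hp : a ^ 2 + b ^ 2 = 5 * n := hp
      -- The factor divisible by 5 decides whether a + bi is a multiple of 2 + i or of 2 - i.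
      have hd : (5 : ℤ) ∣ (2 * a + b) * (2 * a - b) := ⟨a ^ 2 - n, by linear_combination (-1) * hp⟩
      have h5 : Prime (5 : ℤ) := by norm_num
      rcases h5.dvd_or_dvd hd with ⟨c, hc⟩ | ⟨c, hc⟩
      · left
        obtain rfl : b = 5 * c - 2 * a := by linarith
        refine ⟨(c, 2 * c - a), ?_, ?_⟩
        · change c ^ 2 + (2 * c - a) ^ 2 = n
          linarith
        · simp only [f, Prod.mk.injEq]
          constructor <;> ring
      · right
        obtain rfl : b = 2 * a - 5 * c := by linarith
        refine ⟨(c, a - 2 * c), ?_, ?_⟩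
        · change c ^ 2 + (a - 2 * c) ^ 2 = n
          linarith
        · simp only [g, Prod.mk.injEq]
          constructor <;> ring
  have hI : f '' circle n ∩ g '' circle n = h '' {p : ℤ × ℤ | 5 * (p.1 ^ 2 + p.2 ^ 2) = n} := by
    ext ⟨a, b⟩
    constructor
    · rintro ⟨⟨⟨x, y⟩, hp, hq⟩, ⟨⟨x', y'⟩, -, hq'⟩⟩
      have hp : x ^ 2 + y ^ 2 = n := hp
      simp only [f, g, Prod.mk.injEq] at hq hq'
      -- From 5x = 2a + b and 5x' = 2a - b one gets x + x' = 4a/5 and x - x' = 2b/5, whence both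
      -- witnesses.
      obtain ⟨u, hu⟩ : ∃ u, a = 5 * u := ⟨a - x - x', by omega⟩
      obtain ⟨v, hv⟩ : ∃ v, b = 5 * v := ⟨b - 2 * (x - x'), by omega⟩
      refine ⟨(u, v), ?_, by simp only [h, hu, hv]⟩
      change 5 * (u ^ 2 + v ^ 2) = n
      obtain rfl : x = 2 * u + v := by omega
      obtain rfl : y = 2 * v - u := by omega
      rw [← hp]
      ring
    · rintro ⟨⟨u, v⟩, hp, hq⟩
      have hp : 5 * (u ^ 2 + v ^ 2) = n := hp
      simp only [h, Prod.mk.injEq] at hq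
      obtain ⟨rfl, rfl⟩ := hq
      refine ⟨⟨(2 * u + v, 2 * v - u), ?_, ?_⟩, ⟨(2 * u - v, u + 2 * v), ?_, ?_⟩⟩
      · change (2 * u + v) ^ 2 + (2 * v - u) ^ 2 = n
        rw [← hp]
        ring
      · simp only [f, Prod.mk.injEq]
        constructor <;> ring
      · change (2 * u - v) ^ 2 + (u + 2 * v) ^ 2 = n
        rw [← hp]
        ring
      · simp only [g, Prod.mk.injEq]
        constructor <;> ring
  have h1 := finsum_mem_union_inter (f := w) ((finite_circle n).image f) ((finite_circle n).image g)
  rw [hU, hI, finsum_mem_image hf.injOn, finsum_mem_image hg.injOn, finsum_mem_image hh.injOn] at h1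
  rw [finsum_mem_add_distrib (finite_circle n)]
  exact h1

theorem coeff_phi_sq (n : ℕ) :
    coeff n (phi ^ 2) = ∑ᶠ p ∈ circle n, ((p.1 + p.2).negOnePow : ℤ) := by
  rw [sq, phi, formalSum_mul finFibers_sq finFibers_sq, coeff_formalSum]
  refine finsum_congr fun p ↦ ?_
  have h : (p.1.natAbs ^ 2 + p.2.natAbs ^ 2 = n) ↔ p ∈ circle n := by
    change _ ↔ p.1 ^ 2 + p.2 ^ 2 = n
    zify
    rw [sq_abs, sq_abs]
  rw [Int.negOnePow_add, Units.val_mul, h]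

/-- The action of the Hecke operator at five on sums of two squares. -/
theorem sect_zero_phi_sq : sect 0 (phi ^ 2) + dil 5 (phi ^ 2) = 2 * phi ^ 2 := by
  ext n
  have h := finsum_circle_five_mul (fun p ↦ ((p.1 + p.2).negOnePow : ℤ)) n
  have hw : ∀ p : ℤ × ℤ, ((2 * p.1 - p.2 + (p.1 + 2 * p.2)).negOnePow : ℤ) +
      ((2 * p.1 + p.2 + (-p.1 + 2 * p.2)).negOnePow : ℤ) =
      2 * ((p.1 + p.2).negOnePow : ℤ) := by
    intro p
    rw [show 2 * p.1 - p.2 + (p.1 + 2 * p.2) = p.1 + p.2 + 2 * p.1 by ring,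
      show 2 * p.1 + p.2 + (-p.1 + 2 * p.2) = p.1 + p.2 + 2 * p.2 by ring,
      Int.negOnePow_add _ (2 * p.1), Int.negOnePow_add _ (2 * p.2), Int.negOnePow_two_mul,
      Int.negOnePow_two_mul, mul_one, two_mul]
  have h5 : ∀ p : ℤ × ℤ, (5 * p.1 + 5 * p.2).negOnePow = (p.1 + p.2).negOnePow := fun p ↦ by
    rw [← mul_add, negOnePow_five_mul]
  simp only [hw, h5] at h
  rw [map_add, coeff_sect, add_zero, coeff_phi_sq, coeff_dil,
    show (2 : ℤ⟦X⟧) = C 2 from rfl, coeff_C_mul, coeff_phi_sq n,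
    show (2 : ℤ) * ∑ᶠ p ∈ circle n, ((p.1 + p.2).negOnePow : ℤ) =
      ∑ᶠ p ∈ circle n, 2 * ((p.1 + p.2).negOnePow : ℤ) from
      (AddMonoidHom.mulLeft (2 : ℤ)).map_finsum_mem _ (finite_circle n), ← h]
  push_cast
  congr 1
  split_ifs with hn
  · obtain ⟨k, rfl⟩ := hn
    rw [Nat.mul_div_cancel_left _ (by norm_num), coeff_phi_sq]
    refine finsum_mem_congr ?_ fun _ _ ↦ rfl
    ext p
    change p.1 ^ 2 + p.2 ^ 2 = _ ↔ 5 * (p.1 ^ 2 + p.2 ^ 2) = _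
    push_cast
    constructor <;> intro h <;> linarith
  · refine (finsum_mem_eq_zero_of_forall_eq_zero fun p hp ↦ ?_).symm
    have hp : 5 * (p.1 ^ 2 + p.2 ^ 2) = (n : ℤ) := hp
    exact absurd (Int.natCast_dvd_natCast.1 ⟨_, hp.symm⟩) hn

/-- The odd function `x ↦ χ₄ x * x`. -/
def twistedId (x : ℤ) : ℤ := if x % 4 = 1 then x else if x % 4 = 3 then -x else 0

theorem twistedId_two_mul_add_one (m : ℤ) :
    twistedId (2 * m + 1) = (m.negOnePow : ℤ) * (2 * m + 1) := by
  rcases Int.even_or_odd m with h | h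
  · rw [Int.negOnePow_even m h, twistedId, if_pos (by obtain ⟨k, rfl⟩ := h; omega)]
    simp
  · rw [Int.negOnePow_odd m h, twistedId, if_neg (by obtain ⟨k, rfl⟩ := h; omega),
      if_pos (by obtain ⟨k, rfl⟩ := h; omega)]
    simp

theorem odd_of_mem_circle {n : ℤ} {p : ℤ × ℤ} (hp : p ∈ circle (8 * n + 2)) :
    p.1 % 2 = 1 ∧ p.2 % 2 = 1 := by
  have hp : p.1 ^ 2 + p.2 ^ 2 = 8 * n + 2 := hp
  obtain ⟨x, y⟩ := p
  dsimp only at hp ⊢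
  have h2 := congrArg (Int.cast : ℤ → ZMod 8) hp
  push_cast at h2
  rw [show (8 : ZMod 8) = 0 from rfl, zero_mul, zero_add] at h2
  rw [← Int.odd_iff, ← Int.odd_iff]
  by_contra hcon
  have : (∃ k, x = 2 * k) ∨ (∃ k, y = 2 * k) := by
    rw [not_and_or, Int.not_odd_iff_even, Int.not_odd_iff_even, even_iff_exists_two_mul,
      even_iff_exists_two_mul] at hcon
    exact hcon
  rcases this with ⟨k, rfl⟩ | ⟨k, rfl⟩
  · push_cast at h2
    generalize (k : ZMod 8) = a at h2
    generalize (y : ZMod 8) = b at h2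
    revert a b; decide
  · push_cast at h2
    generalize (k : ZMod 8) = a at h2
    generalize (x : ZMod 8) = b at h2
    revert a b; decide

/-- Completing squares by (2m + 1)² = 8 `tri` m + 1 sends index n to the circle 8n + 2, on which
both coordinates are odd. -/
theorem coeff_four_mul_euler_pow_six (n : ℕ) :
    coeff n (C 4 * euler ^ 6) = ∑ᶠ p ∈ circle (8 * n + 2), twistedId p.1 * twistedId p.2 := by
  have h1 : C 4 * euler ^ 6 = (2 * euler ^ 3) * (2 * euler ^ 3) := by
    rw [show (C 4 : ℤ⟦X⟧) = 4 from rfl]; ring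
  rw [h1, two_mul_euler_cube, formalSum_mul finFibers_tri finFibers_tri, coeff_formalSum]
  refine finsum_mem_eq_of_bijOn (s := {p : ℤ × ℤ | tri p.1 + tri p.2 = n})
    (fun p ↦ (2 * p.1 + 1, 2 * p.2 + 1)) ⟨?_, ?_, ?_⟩ ?_
  · rintro ⟨a, b⟩ hp
    have hp : tri a + tri b = n := hp
    change (2 * a + 1) ^ 2 + (2 * b + 1) ^ 2 = _
    have h1 := two_mul_tri a
    have h2 := two_mul_tri b
    zify at hp
    linear_combination (-4) * h1 - 4 * h2 + 8 * hp
  · rintro ⟨a, b⟩ - ⟨c, d⟩ - h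
    simp only [Prod.mk.injEq] at h
    ext <;> omega
  · rintro ⟨x, y⟩ hp
    have ho := odd_of_mem_circle hp
    have hp : x ^ 2 + y ^ 2 = 8 * n + 2 := hp
    dsimp only at ho
    obtain ⟨a, rfl⟩ : ∃ a, x = 2 * a + 1 := ⟨x / 2, by omega⟩
    obtain ⟨b, rfl⟩ : ∃ b, y = 2 * b + 1 := ⟨y / 2, by omega⟩
    refine ⟨(a, b), ?_, rfl⟩
    change tri a + tri b = n
    have h1 := two_mul_tri a
    have h2 := two_mul_tri b
    zify
    linarith
  · rintro ⟨a, b⟩ -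
    simp only [twistedId_two_mul_add_one]

/-- Up to sign the products are 2x² + 3xy - 2y² and -2x² + 3xy + 2y²; in each class mod 4 the signs
coincide, so the squares cancel. The result is the Hecke eigenvalue -6. -/
theorem twistedId_rotate {x y : ℤ} (hx : x % 2 = 1) (hy : y % 2 = 1) :
    twistedId (2 * x - y) * twistedId (x + 2 * y) +
      twistedId (2 * x + y) * twistedId (-x + 2 * y) = -6 * (twistedId x * twistedId y) := by
  have hx4 : x % 4 = 1 ∨ x % 4 = 3 := by omega
  have hy4 : y % 4 = 1 ∨ y % 4 = 3 := by omega
  have e1 : ∀ z : ℤ, z % 4 = 1 → twistedId z = z := fun z h ↦ if_pos h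
  have e3 : ∀ z : ℤ, z % 4 = 3 → twistedId z = -z := fun z h ↦ by
    rw [twistedId, if_neg (by omega), if_pos h]
  rcases hx4 with hx | hx <;> rcases hy4 with hy | hy
  · rw [e1 x hx, e1 y hy, e1 (2 * x - y) (by omega), e3 (x + 2 * y) (by omega),
      e3 (2 * x + y) (by omega), e1 (-x + 2 * y) (by omega)]
    ring
  · rw [e1 x hx, e3 y hy, e3 (2 * x - y) (by omega), e3 (x + 2 * y) (by omega),
      e1 (2 * x + y) (by omega), e1 (-x + 2 * y) (by omega)]
    ring
  · rw [e3 x hx, e1 y hy, e1 (2 * x - y) (by omega), e1 (x + 2 * y) (by omega),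
      e3 (2 * x + y) (by omega), e3 (-x + 2 * y) (by omega)]
    ring
  · rw [e3 x hx, e3 y hy, e3 (2 * x - y) (by omega), e1 (x + 2 * y) (by omega),
      e1 (2 * x + y) (by omega), e3 (-x + 2 * y) (by omega)]
    ring

theorem twistedId_five_mul (x : ℤ) : twistedId (5 * x) = 5 * twistedId x := by
  rw [twistedId, twistedId, show 5 * x % 4 = x % 4 by omega]
  split_ifs <;> ring

/-- The action of the Hecke operator at five on the sixth power of Euler's product. -/
theorem sect_one_euler_pow_six :
    sect 1 (euler ^ 6) = -6 * euler ^ 6 - 25 * (X * dil 5 (euler ^ 6)) := by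
  have h4 : (C 4 : ℤ⟦X⟧) ≠ 0 := fun h ↦ by
    have := congrArg (coeff 0) h
    rw [coeff_zero_C, map_zero] at this
    norm_num at this
  have key : sect 1 (C 4 * euler ^ 6) + C 25 * (X * dil 5 (C 4 * euler ^ 6)) =
      C (-6) * (C 4 * euler ^ 6) := by
    ext n
    have h := finsum_circle_five_mul (fun p ↦ twistedId p.1 * twistedId p.2) (8 * n + 2)
    simp only [twistedId_five_mul] at h
    have h6 : ∑ᶠ p ∈ circle (8 * n + 2), (twistedId (2 * p.1 - p.2) * twistedId (p.1 + 2 * p.2) +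
        twistedId (2 * p.1 + p.2) * twistedId (-p.1 + 2 * p.2)) =
        ∑ᶠ p ∈ circle (8 * n + 2), -6 * (twistedId p.1 * twistedId p.2) :=
      finsum_mem_congr rfl fun p hp ↦
        twistedId_rotate (odd_of_mem_circle hp).1 (odd_of_mem_circle hp).2
    rw [h6] at h
    have hF := coeff_four_mul_euler_pow_six
    generalize C 4 * euler ^ 6 = F at hF ⊢
    rw [map_add, coeff_sect, coeff_C_mul, coeff_C_mul, hF, hF,
      show (-6 : ℤ) * ∑ᶠ p ∈ circle (8 * n + 2), twistedId p.1 * twistedId p.2 =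
        ∑ᶠ p ∈ circle (8 * n + 2), -6 * (twistedId p.1 * twistedId p.2) from
        (AddMonoidHom.mulLeft (-6 : ℤ)).map_finsum_mem _ (finite_circle _), ← h]
    congr 1
    · refine finsum_mem_congr ?_ fun _ _ ↦ rfl
      congr 1
      push_cast
      ring
    have hset : ∀ k : ℕ, n = 5 * k + 1 →
        {p : ℤ × ℤ | 5 * (p.1 ^ 2 + p.2 ^ 2) = 8 * n + 2} = circle (8 * k + 2) := by
      rintro k rfl
      ext p
      change 5 * (p.1 ^ 2 + p.2 ^ 2) = _ ↔ p.1 ^ 2 + p.2 ^ 2 = _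
      push_cast
      constructor <;> intro h <;> linarith
    have hzero : (∀ k : ℕ, n ≠ 5 * k + 1) →
        {p : ℤ × ℤ | 5 * (p.1 ^ 2 + p.2 ^ 2) = 8 * n + 2} = ∅ := by
      intro hk
      refine Set.eq_empty_of_forall_notMem fun p hp ↦ ?_
      have hp : 5 * (p.1 ^ 2 + p.2 ^ 2) = 8 * (n : ℤ) + 2 := hp
      generalize p.1 ^ 2 + p.2 ^ 2 = q at hp
      exact hk (n / 5) (by omega)
    rcases n with _ | n
    · rw [hzero (by omega), finsum_mem_empty, coeff_zero_X_mul, mul_zero]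
    · rw [coeff_succ_X_mul, coeff_dil]
      split_ifs with hd
      · obtain ⟨k, rfl⟩ := hd
        rw [Nat.mul_div_cancel_left _ (by norm_num), hset k rfl, hF]
        rw [show (25 : ℤ) * ∑ᶠ p ∈ circle (8 * k + 2), twistedId p.1 * twistedId p.2 =
          ∑ᶠ p ∈ circle (8 * k + 2), 25 * (twistedId p.1 * twistedId p.2) from
          (AddMonoidHom.mulLeft (25 : ℤ)).map_finsum_mem _ (finite_circle _)]
        exact finsum_mem_congr rfl fun p _ ↦ by ring
      · rw [hzero (fun k hk ↦ hd ⟨k, by omega⟩), finsum_mem_empty, mul_zero]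
  rw [sect_C_mul] at key
  rw [map_mul, map_neg C] at key
  rw [show (-6 : ℤ⟦X⟧) = -C 6 from rfl, show (25 : ℤ⟦X⟧) = C 25 from rfl]
  have h5 : dil 5 (C 4) = C 4 := PowerSeries.expand_C 5 (by norm_num) 4
  rw [h5] at key
  apply mul_left_cancel₀ h4
  linear_combination key

end Gaussian
end QSeries

namespace QSeries
open PowerSeries Filter Finset

/-! ### The rational parametrisation of the 5-dissections. -/

section Curve

/-- The field of fractions of the ring of formal power series. -/
abbrev SeriesField : Type := FractionRing ℤ⟦X⟧

/-- The embedding of power series into their field of fractions. -/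
noncomputable abbrev toField : ℤ⟦X⟧ →+* SeriesField := algebraMap ℤ⟦X⟧ SeriesField

theorem toField_injective : Function.Injective toField := IsFractionRing.injective _ _

theorem toField_ne_zero {f : ℤ⟦X⟧} (hf : coeff 0 f ≠ 0) : toField f ≠ 0 := fun h ↦ by
  rw [map_eq_zero_iff _ toField_injective] at h
  simp [h] at hf

/-- The sections of `f` modulo five are `c * u ^ i * gᵢ`. -/
structure HasSects (u c : SeriesField) (f : ℤ⟦X⟧) (g₀ g₁ g₂ g₃ g₄ : SeriesField) : Prop where
  zero : toField (sect 0 f) = c * g₀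
  one : toField (sect 1 f) = c * u * g₁
  two : toField (sect 2 f) = c * u ^ 2 * g₂
  three : toField (sect 3 f) = c * u ^ 3 * g₃
  four : toField (sect 4 f) = c * u ^ 4 * g₄

/-- Weighting section i by u^i makes u disappear: a wrap-around in the degree mod 5 costs X u⁵ = T,
itself a function of r, so products are computed in r alone. -/
theorem HasSects.mul {u T c c' : SeriesField} {f f' : ℤ⟦X⟧}
    {g₀ g₁ g₂ g₃ g₄ g₀' g₁' g₂' g₃' g₄' : SeriesField} (hT : T = toField X * u ^ 5)
    (h : HasSects u c f g₀ g₁ g₂ g₃ g₄) (h' : HasSects u c' f' g₀' g₁' g₂' g₃' g₄') :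
    HasSects u (c * c') (f * f')
      (g₀ * g₀' + T * (g₁ * g₄' + g₂ * g₃' + g₃ * g₂' + g₄ * g₁'))
      (g₀ * g₁' + g₁ * g₀' + T * (g₂ * g₄' + g₃ * g₃' + g₄ * g₂'))
      (g₀ * g₂' + g₁ * g₁' + g₂ * g₀' + T * (g₃ * g₄' + g₄ * g₃'))
      (g₀ * g₃' + g₁ * g₂' + g₂ * g₁' + g₃ * g₀' + T * (g₄ * g₄'))
      (g₀ * g₄' + g₁ * g₃' + g₂ * g₂' + g₃ * g₁' + g₄ * g₀') := by
  have key := ofSects_mul (sect 0 f) (sect 1 f) (sect 2 f) (sect 3 f) (sect 4 f)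
    (sect 0 f') (sect 1 f') (sect 2 f') (sect 3 f') (sect 4 f')
  rw [ofSects_sect, ofSects_sect] at key
  rw [key, hT]
  constructor <;> rw [sect_ofSects (by norm_num)] <;>
    simp only [map_add, map_mul, map_zero, h.zero, h.one, h.two, h.three, h.four, h'.zero, h'.one,
      h'.two, h'.three, h'.four, if_true, if_false, OfNat.ofNat_ne_zero, OfNat.ofNat_ne_one,
      OfNat.zero_ne_ofNat, OfNat.one_ne_ofNat, zero_ne_one, one_ne_zero, Nat.reduceEqDiff] <;> ring

theorem HasSects.congr {u c c' : SeriesField} {f : ℤ⟦X⟧}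
    {g₀ g₁ g₂ g₃ g₄ g₀' g₁' g₂' g₃' g₄' : SeriesField}
    (h : HasSects u c f g₀ g₁ g₂ g₃ g₄) (hc : c = c') (h₀ : g₀ = g₀') (h₁ : g₁ = g₁')
    (h₂ : g₂ = g₂') (h₃ : g₃ = g₃') (h₄ : g₄ = g₄') : HasSects u c' f g₀' g₁' g₂' g₃' g₄' := by
  subst hc h₀ h₁ h₂ h₃ h₄
  exact h

/-- The rational parametrisation forced by the dissection of `euler ^ 2 = phi * dil 2 euler`. -/
theorem curve_of_dissection {K : Type*} [Field K] [NeZero (2 : K)]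
    {A B E P x y t A₂ B₂ E₂ : K} (hE : E ≠ 0) (hP : P ≠ 0) (hB : B ≠ 0) (hA₂ : A₂ ≠ 0)
    (hAB : A * B = E ^ 2) (hEP : E₂ * P = E ^ 2) (hAB₂ : A₂ * B₂ = E₂ ^ 2)
    (h₁ : A * E = x * A₂ + t * y * E₂) (h₃ : E * B = x * E₂ - t * y * B₂)
    (h₄ : B ^ 2 = 2 * y * A₂ - P * B₂) :
    ∃ u r : K, u ≠ 0 ∧ 2 * r - 1 ≠ 0 ∧ B = E * u ∧ A = E / u ∧ x = P * u * r ∧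
      y = P * u ^ 4 * r * (2 * r - 1) ∧ t * u ^ 5 * r * (2 * r - 1) ^ 2 = r - 1 := by
  have h2 : (2 : K) ≠ 0 := NeZero.ne _
  have hE₂ : E₂ ≠ 0 := fun h ↦ by
    rw [h, zero_mul] at hEP
    exact pow_ne_zero 2 hE hEP.symm
  obtain ⟨u, hu⟩ : ∃ u, u = B / E := ⟨_, rfl⟩
  have hu0 : u ≠ 0 := hu ▸ div_ne_zero hB hE
  obtain rfl : B = E * u := by rw [hu]; field_simp
  obtain rfl : A = E / u := by
    field_simp
    apply mul_right_cancel₀ hE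
    linear_combination hAB
  -- The auxiliary ratio ρ expresses the q² data through the rest; adding `e1` and `e3` below
  -- eliminates ty and forces ρ = 2r - 1.
  obtain ⟨ρ, hρ⟩ : ∃ ρ, ρ = E₂ / (A₂ * u ^ 2) := ⟨_, rfl⟩
  have hρ0 : ρ ≠ 0 := hρ ▸ div_ne_zero hE₂ (mul_ne_zero hA₂ (pow_ne_zero 2 hu0))
  have hA₂' : A₂ * (ρ * u ^ 2) = E₂ := by rw [hρ]; field_simp
  have hB₂' : B₂ = E₂ * ρ * u ^ 2 := by
    apply mul_left_cancel₀ hA₂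
    rw [hAB₂]
    linear_combination (-E₂) * hA₂'
  subst hB₂'
  obtain ⟨r, hr⟩ : ∃ r, r = x / (P * u) := ⟨_, rfl⟩
  obtain rfl : x = P * u * r := by rw [hr]; field_simp
  have hy : 2 * y = P * u ^ 4 * ρ * (1 + ρ) := by
    apply mul_left_cancel₀ hE₂
    linear_combination (-ρ * u ^ 2) * h₄ - 2 * y * hA₂' - (ρ * u ^ 4) * hEP
  have e1 : P * ρ = P * r + t * y * u * ρ := by
    apply mul_left_cancel₀ (mul_ne_zero hE₂ hu0)
    have : E ^ 2 = u * (P * u * r * A₂ + t * y * E₂) := by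
      rw [← h₁]; field_simp
    linear_combination (ρ * u) * hEP + (ρ * u) * this + (P * u * r) * hA₂'
  have e3 : P = P * r - t * y * ρ * u := by
    apply mul_left_cancel₀ (mul_ne_zero hE₂ hu0)
    linear_combination u * hEP + h₃
  have hρr : ρ = 2 * r - 1 := by
    apply mul_left_cancel₀ hP
    linear_combination e1 + e3
  subst hρr
  have hy' : y = P * u ^ 4 * r * (2 * r - 1) := by
    apply mul_left_cancel₀ h2
    linear_combination hy
  refine ⟨u, r, hu0, hρ0, rfl, rfl, rfl, hy', ?_⟩
  apply mul_left_cancel₀ hP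
  rw [hy'] at e3
  linear_combination e3

theorem coeff_zero_euler : coeff 0 euler = 1 := by simp [euler, iprod]

theorem coeff_zero_phi : coeff 0 phi = 1 := by
  rw [phi, coeff_formalSum, finsum_eq_single _ 0]
  · simp
  · intro m hm
    simp [hm]

theorem coeff_zero_dil (k : ℕ) [NeZero k] (f : ℤ⟦X⟧) : coeff 0 (dil k f) = coeff 0 f := by
  simp

theorem coeff_zero_phiOne : coeff 0 phiOne = 1 := by
  rw [phiOne, coeff_formalSum, finsum_eq_single _ 0]
  · simp [tpExp, tri]
  · intro m hm
    have := two_mul_tpExp 7 3 m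
    have h0 : tpExp 7 3 m ≠ 0 := by
      intro h
      rw [h] at this
      push_cast at this
      have h1 : m * (5 * m + 2) = 0 := by linarith
      rcases mul_eq_zero.1 h1 with h | h <;> omega
    simp [h0]

theorem coeff_two_euler : coeff 2 euler = -1 := by
  simp only [euler, iprod, coeff_mk, prod_range_succ, range_zero, prod_empty, one_mul, zero_add]
  rw [show ((1 - X ^ 1) * (1 - X ^ (1 + 1)) * (1 - X ^ (2 + 1)) : ℤ⟦X⟧) =
    1 - X ^ 1 - X ^ 2 + X ^ 4 + X ^ 5 - X ^ 6 by ring]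
  simp [coeff_X_pow, coeff_one, coeff_X]

/-- The rational parametrisation of the dissections of `euler` and `phi` modulo five. -/
theorem exists_parameter : ∃ u r T : SeriesField, u ≠ 0 ∧ r ≠ 0 ∧ 2 * r - 1 ≠ 0 ∧
    T = toField X * u ^ 5 ∧ T * (r * (2 * r - 1) ^ 2) = r - 1 ∧
    toField phiOne = toField (dil 5 phi) * u * r ∧
    toField phiFour = toField (dil 5 phi) * u ^ 4 * r * (2 * r - 1) ∧
    HasSects u (toField (dil 5 euler) / u) euler 1 (-1) (-1) 0 0 ∧
    HasSects u (toField (dil 5 phi)) phi 1 (-(2 * r)) 0 0 (2 * r * (2 * r - 1)) := by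
  have hsq : ofSects (sect 0 euler) (-dil 5 euler) (sect 2 euler) 0 0 *
      ofSects (sect 0 euler) (-dil 5 euler) (sect 2 euler) 0 0 =
      ofSects (dil 5 phi) (-(2 * phiOne)) 0 0 (2 * phiFour) *
      ofSects (dil 2 (sect 0 euler)) 0 (-dil 2 (dil 5 euler)) 0 (dil 2 (sect 2 euler)) := by
    rw [← euler_eq_ofSects, ← phi_eq_ofSects, ← dil_two_euler_eq_ofSects, phi_mul, sq]
  rw [ofSects_mul, ofSects_mul] at hsq
  have s1 := congrArg (sect 1) hsq
  have s2 := congrArg (sect 2) hsq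
  have s3 := congrArg (sect 3) hsq
  have s4 := congrArg (sect 4) hsq
  rw [sect_ofSects (by norm_num), sect_ofSects (by norm_num)] at s1 s2 s3 s4
  simp only [if_true, if_false, OfNat.ofNat_ne_zero, OfNat.ofNat_ne_one,
      OfNat.one_ne_ofNat, one_ne_zero, Nat.reduceEqDiff, zero_add, add_zero,
      mul_zero, zero_mul] at s1 s2 s3 s4
  have hEP : dil 2 (dil 5 euler) * dil 5 phi = dil 5 euler ^ 2 := by
    rw [dil_two_dil_five, ← map_mul, ← map_pow, ← phi_mul, mul_comm]
  have two_ne : (C 2 : ℤ⟦X⟧) ≠ 0 := fun h ↦ by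
    have := congrArg (coeff 0) h
    rw [coeff_zero_C, map_zero] at this
    norm_num at this
  have two_eq : (C 2 : ℤ⟦X⟧) = 2 := rfl
  -- Section 2 of E² = φE(q²) reads 2·`sect 0 euler`·`sect 2 euler` + E(q⁵)² = -φ(q⁵)E(q¹⁰), and the
  -- right side is -E(q⁵)².
  have hAB : sect 0 euler * -sect 2 euler = dil 5 euler ^ 2 := by
    apply mul_left_cancel₀ two_ne
    rw [two_eq]
    linear_combination -s2 + hEP
  have h1 : sect 0 euler * dil 5 euler = phiOne * dil 2 (sect 0 euler) +
      X * phiFour * dil 2 (dil 5 euler) := by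
    apply mul_left_cancel₀ two_ne
    rw [two_eq]
    linear_combination -s1
  have h3 : dil 5 euler * -sect 2 euler = phiOne * dil 2 (dil 5 euler) -
      X * phiFour * dil 2 (-sect 2 euler) := by
    apply mul_left_cancel₀ two_ne
    rw [two_eq, map_neg]
    linear_combination s3
  have h4 : (-sect 2 euler) ^ 2 = 2 * phiFour * dil 2 (sect 0 euler) -
      dil 5 phi * dil 2 (-sect 2 euler) := by
    rw [map_neg]
    linear_combination s4
  have hAB2 := congrArg (dil 2) hAB
  rw [map_mul, map_pow] at hAB2
  have cS : coeff 0 (-sect 2 euler) = 1 := by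
    rw [map_neg, coeff_sect, mul_zero, zero_add, coeff_two_euler, neg_neg]
  have cA : coeff 0 (sect 0 euler) = 1 := by rw [coeff_sect]; exact coeff_zero_euler
  have hE : toField (dil 5 euler) ≠ 0 :=
    toField_ne_zero (by rw [coeff_zero_dil, coeff_zero_euler]; exact one_ne_zero)
  have hP : toField (dil 5 phi) ≠ 0 :=
    toField_ne_zero (by rw [coeff_zero_dil, coeff_zero_phi]; exact one_ne_zero)
  have hB : toField (-sect 2 euler) ≠ 0 := toField_ne_zero (by rw [cS]; exact one_ne_zero)
  have hA2 : toField (dil 2 (sect 0 euler)) ≠ 0 :=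
    toField_ne_zero (by rw [coeff_zero_dil, cA]; exact one_ne_zero)
  have hx : toField phiOne ≠ 0 := toField_ne_zero (by rw [coeff_zero_phiOne]; exact one_ne_zero)
  have : NeZero (2 : SeriesField) := ⟨by
    rw [← map_ofNat toField 2, ← two_eq]
    exact (map_ne_zero_iff _ toField_injective).2 two_ne⟩
  obtain ⟨u, r, hu, hr, e1, e2, e3, e4, e5⟩ := curve_of_dissection
    (t := toField X) (y := toField phiFour) hE hP hB hA2
    (by simpa only [map_mul, map_pow] using congrArg toField hAB)
    (by simpa only [map_mul, map_pow] using congrArg toField hEP)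
    (by simpa only [map_mul, map_pow] using congrArg toField hAB2)
    (by simpa only [map_mul, map_add] using congrArg toField h1)
    (by simpa only [map_mul, map_sub] using congrArg toField h3)
    (by simpa only [map_mul, map_sub, map_pow, map_ofNat] using congrArg toField h4)
  have hr0 : r ≠ 0 := by rintro rfl; rw [mul_zero] at e3; exact hx e3
  refine ⟨u, r, toField X * u ^ 5, hu, hr0, hr, rfl, by linear_combination e5, e3, e4,
    ⟨by rw [e2, mul_one], ?_, ?_, ?_, ?_⟩, ⟨?_, ?_, ?_, ?_, ?_⟩⟩
  · rw [sect_one_euler, map_neg]; field_simp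
  · rw [map_neg, neg_eq_iff_eq_neg] at e1
    rw [e1]; field_simp
  · rw [sect_three_euler, map_zero, mul_zero]
  · rw [sect_four_euler, map_zero, mul_zero]
  · rw [sect_zero_phi, mul_one]
  · rw [sect_one_phi, map_neg, map_mul, e3, map_ofNat]; ring
  · rw [sect_two_phi, map_zero, mul_zero]
  · rw [sect_three_phi, map_zero, mul_zero]
  · rw [sect_four_phi, map_mul, e4, map_ofNat]; ring

end Curve
end QSeries

namespace QSeries
open PowerSeries Filter Finset

/-! ### Action of the sections on products of E and φ. -/

section Identities

/-- The rational parametrisation of `euler`, `phi` and their dissections modulo five. -/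
structure Parameter (u r T : SeriesField) : Prop where
  u_ne : u ≠ 0
  r_ne : r ≠ 0
  m_ne : r * 2 - 1 ≠ 0
  T_eq : T = toField X * u ^ 5
  T_curve : T = (r - 1) / (r * (2 * r - 1) ^ 2)
  euler : HasSects u (toField (dil 5 euler) / u) euler 1 (-1) (-1) 0 0
  phi : HasSects u (toField (dil 5 phi)) phi 1 (-(2 * r)) 0 0 (2 * r * (2 * r - 1))
  phi_sq : toField QSeries.phi ^ 2 =
    toField (dil 5 QSeries.phi) ^ 2 * (1 - 4 * r * (r - 1) / (2 * r - 1))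
  phi_eq : toField QSeries.phi * toField (dil 5 QSeries.euler) ^ 5 =
    toField QSeries.euler * toField (dil 5 QSeries.phi) ^ 5 * u ^ 5 * r ^ 2 * (2 * r - 1)
  euler_pow_six : toField QSeries.euler ^ 6 =
    toField (dil 5 QSeries.euler) ^ 6 / u ^ 5 * (1 - 11 * T - T ^ 2)

theorem toField_phi_ne : toField phi ≠ 0 :=
  toField_ne_zero (by rw [coeff_zero_phi]; exact one_ne_zero)

theorem toField_dil_euler_ne : toField (dil 5 euler) ≠ 0 :=
  toField_ne_zero (by rw [coeff_zero_dil, coeff_zero_euler]; exact one_ne_zero)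

theorem toField_dil_phi_ne : toField (dil 5 phi) ≠ 0 :=
  toField_ne_zero (by rw [coeff_zero_dil, coeff_zero_phi]; exact one_ne_zero)

theorem natCast_ne_zero_of_ne (n : ℕ) (hn : n ≠ 0) : (n : SeriesField) ≠ 0 := by
  rw [← map_natCast toField n]
  refine toField_ne_zero ?_
  rw [← map_natCast (C : ℤ →+* ℤ⟦X⟧) n, coeff_zero_C]
  exact_mod_cast hn

theorem Parameter.phi_sq_sects {u r T : SeriesField} (h : Parameter u r T) :
    HasSects u (toField (dil 5 QSeries.phi) ^ 2) (QSeries.phi ^ 2)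
      (1 - 8 * r * (r - 1) / (2 * r - 1)) (-(4 * r)) (4 * r ^ 2) (4 * r * (r - 1))
      (4 * r * (2 * r - 1)) := by
  have := h.r_ne
  have := h.m_ne
  rw [sq QSeries.phi]
  have key : T * (r * (2 * r - 1) ^ 2) = r - 1 := by rw [h.T_curve]; field_simp
  exact (h.phi.mul h.T_eq h.phi).congr (by ring) (by rw [h.T_curve]; field_simp; ring) (by ring)
    (by ring) (by linear_combination 4 * r * key) (by ring)

/-- The Hecke relations involve the undissected φ² and E⁶ linearly, so computing the relevant
section from the parametrisation solves for them; 1 - 11T - T² is Ramanujan's polynomial for E⁶. -/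
theorem exists_parameter_identities : ∃ u r T : SeriesField, Parameter u r T := by
  obtain ⟨u, r, T, hu, hr, hm, hT, hTc, h1, h4, he, hp⟩ := exists_parameter
  replace hm : r * 2 - 1 ≠ 0 := by rwa [mul_comm]
  have hT' : T = (r - 1) / (r * (2 * r - 1) ^ 2) := by
    rw [← hTc]; field_simp
  have hE := toField_dil_euler_ne
  have hP := toField_dil_phi_ne
  have h2 := natCast_ne_zero_of_ne 2 two_ne_zero
  have h6 := natCast_ne_zero_of_ne 6 (by norm_num)
  push_cast at h2 h6
  refine ⟨u, r, T, hu, hr, hm, hT, hT', he, hp, ?_, ?_, ?_⟩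
  · have hz := (hp.mul hT hp).zero
    rw [← sq phi] at hz
    have key := congrArg toField sect_zero_phi_sq
    rw [map_add, hz, map_mul, map_pow, map_pow, map_pow, map_ofNat, hT'] at key
    apply mul_left_cancel₀ h2
    rw [← key]
    field_simp
    ring
  · have key := congrArg toField phiOne_mul_phiFour_mul
    simp only [map_mul, map_pow, h1, h4] at key
    linear_combination -key
  · have h2 := he.mul hT he
    have h6' := (h2.mul hT (h2.mul hT h2)).one
    rw [show euler * euler * (euler * euler * (euler * euler)) = euler ^ 6 by ring,
      sect_one_euler_pow_six] at h6'
    simp only [map_mul, map_pow, map_sub, map_neg, map_ofNat] at h6'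
    have hX : toField X = T / u ^ 5 := by rw [hT]; field_simp
    rw [hX] at h6'
    apply mul_left_cancel₀ h6
    rw [← sub_eq_zero] at h6' ⊢
    rw [← neg_eq_zero, ← h6']
    field_simp
    ring

namespace Parameter

variable {u r T : SeriesField} (h : Parameter u r T)
include h

theorem euler_pow_five_mul_phi : toField (QSeries.euler ^ 5 * QSeries.phi) =
    toField (dil 5 QSeries.euler) * toField (dil 5 QSeries.phi) ^ 5 *
      (r ^ 2 * (2 * r - 1) * (1 - 11 * T - T ^ 2)) := by
  have hE := toField_dil_euler_ne
  have hu := h.u_ne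
  apply mul_right_cancel₀ (pow_ne_zero 5 hE)
  have h6 := h.euler_pow_six
  field_simp at h6
  rw [map_mul, map_pow]
  linear_combination toField QSeries.euler ^ 5 * h.phi_eq +
    toField (dil 5 QSeries.phi) ^ 5 * r ^ 2 * (2 * r - 1) * h6

/-- On the curve two sections vanish and one is constant, which keeps later products small. -/
theorem euler_mul_phi_sq_sects :
    HasSects u (toField (dil 5 QSeries.euler) / u * toField (dil 5 QSeries.phi) ^ 2)
      (QSeries.euler * QSeries.phi ^ 2)
      (1 - 8 * r * (r - 1) / (2 * r - 1) - 4 * (r - 1) * (3 * r - 2) / (2 * r - 1) ^ 2) (-5)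
      (4 * r ^ 2 + 4 * r - 1 + 8 * r * (r - 1) / (2 * r - 1)) 0 0 := by
  have := h.r_ne
  have := h.m_ne
  refine (h.euler.mul h.T_eq h.phi_sq_sects).congr rfl ?_ ?_ ?_ ?_ ?_ <;>
    (try simp only [h.T_curve]) <;> field_simp <;> ring

theorem euler_sq_sects : HasSects u (toField (dil 5 QSeries.euler) ^ 2 / u ^ 2)
    (QSeries.euler ^ 2) 1 (-2) (-1) 2 1 := by
  rw [sq QSeries.euler]
  exact (h.euler.mul h.T_eq h.euler).congr (by ring) (by ring) (by ring) (by ring) (by ring)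
    (by ring)

theorem toField_euler : toField QSeries.euler = toField QSeries.phi *
    toField (dil 5 QSeries.euler) ^ 5 /
      (toField (dil 5 QSeries.phi) ^ 5 * u ^ 5 * r ^ 2 * (2 * r - 1)) := by
  have := h.r_ne
  have := h.m_ne
  have := h.u_ne
  have := toField_dil_phi_ne
  field_simp
  linear_combination -h.phi_eq

theorem toField_X : toField X = (r - 1) / (r * (2 * r - 1) ^ 2 * u ^ 5) := by
  have := h.r_ne
  have := h.m_ne
  have := h.u_ne
  have h2 := h.T_curve
  rw [h.T_eq] at h2
  field_simp at h2 ⊢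
  linear_combination h2

theorem phi_sq_ne : 1 - 4 * r * (r - 1) / (2 * r - 1) ≠ 0 := by
  intro h0
  have := h.phi_sq
  rw [h0, mul_zero] at this
  exact pow_ne_zero 2 toField_phi_ne this

end Parameter
/-- The first section of `euler * phi ^ 3`. -/
theorem sect_one_euler_mul_phi_pow_three : sect 1 (euler * phi ^ 3) =
    5 * (dil 5 euler * dil 5 phi ^ 3) - 12 * (euler ^ 3 * dil 2 euler) := by
  obtain ⟨u, r, T, h⟩ := exists_parameter_identities
  apply toField_injective
  have hr := h.r_ne
  have hm := h.m_ne
  have hu := h.u_ne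
  have hF := h.phi_sq_ne
  have hP := toField_dil_phi_ne
  have key := (h.euler_mul_phi_sq_sects.mul h.T_eq h.phi).one
  have hb := h.euler_pow_five_mul_phi
  rw [show euler ^ 5 * phi = euler ^ 3 * dil 2 euler * phi ^ 2 by
    linear_combination (-(euler ^ 3 * phi)) * phi_mul,
    map_mul, map_pow, h.phi_sq] at hb
  rw [show euler * phi ^ 2 * phi = euler * phi ^ 3 by ring] at key
  -- Only E³E(q²)φ² = E⁵φ has a known parametrised form, so both sides are multiplied by φ².
  apply mul_right_cancel₀ (mul_ne_zero (pow_ne_zero 2 hP) hF)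
  rw [map_sub, map_mul _ 12, sub_mul, mul_assoc (toField 12), hb, key, h.T_curve]
  simp only [map_mul, map_pow, map_ofNat]
  field_simp
  ring

/-- The first section of `euler * phi ^ 5`. -/
theorem sect_one_euler_mul_phi_pow_five : sect 1 (euler * phi ^ 5) =
    25 * (dil 5 euler * dil 5 phi ^ 5) - 36 * (euler ^ 5 * phi) := by
  obtain ⟨u, r, T, h⟩ := exists_parameter_identities
  apply toField_injective
  have hr := h.r_ne
  have hm := h.m_ne
  have hu := h.u_ne
  have key := ((h.euler_mul_phi_sq_sects.mul h.T_eq h.phi_sq_sects).mul h.T_eq h.phi).one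
  rw [show euler * phi ^ 2 * phi ^ 2 * phi = euler * phi ^ 5 by ring] at key
  rw [map_sub, map_mul _ 36, h.euler_pow_five_mul_phi, key, h.T_curve]
  simp only [map_mul, map_pow, map_ofNat]
  field_simp
  ring

/-- The first section of `euler * phi ^ 7`. -/
theorem sect_one_euler_mul_phi_pow_seven : sect 1 (euler * phi ^ 7) =
    125 * (dil 5 euler * dil 5 phi ^ 7) - 140 * (euler ^ 5 * phi ^ 3) := by
  obtain ⟨u, r, T, h⟩ := exists_parameter_identities
  apply toField_injective
  have hr := h.r_ne
  have hm := h.m_ne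
  have hu := h.u_ne
  have key := (((h.euler_mul_phi_sq_sects.mul h.T_eq h.phi_sq_sects).mul h.T_eq
    h.phi_sq_sects).mul h.T_eq h.phi).one
  rw [show euler * phi ^ 2 * phi ^ 2 * phi ^ 2 * phi = euler * phi ^ 7 by ring] at key
  rw [show euler ^ 5 * phi ^ 3 = euler ^ 5 * phi * phi ^ 2 by ring,
    map_sub, map_mul _ 140, map_mul _ (euler ^ 5 * phi), h.euler_pow_five_mul_phi, key, h.T_curve,
    map_pow, h.phi_sq]
  simp only [map_mul, map_pow, map_ofNat]
  field_simp
  ring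

/-- The zeroth section of `euler ^ 5 * phi`. -/
theorem sect_zero_euler_pow_five_mul_phi : sect 0 (euler ^ 5 * phi) =
    euler * phi ^ 5 + 25 * (X * dil 5 (euler ^ 5 * phi)) := by
  obtain ⟨u, r, T, h⟩ := exists_parameter_identities
  apply toField_injective
  have hr := h.r_ne
  have hm := h.m_ne
  have hu := h.u_ne
  have hP := toField_dil_phi_ne
  have key := (((h.euler_sq_sects.mul h.T_eq h.euler_sq_sects).mul h.T_eq h.euler).mul h.T_eq
    h.phi).zero
  rw [show euler ^ 2 * euler ^ 2 * euler * phi = euler ^ 5 * phi by ring] at key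
  simp only [map_mul, map_pow, map_ofNat, map_add]
  -- Trading E for φ makes the power of φ even, and only φ² is a known function of r.
  rw [h.toField_euler, show ∀ a b c : SeriesField, a * b / c * a ^ 5 = (a ^ 2) ^ 3 * b / c by
    intros; ring, h.phi_sq, key, h.T_curve, h.toField_X]
  field_simp
  ring

/-- The zeroth section of `euler ^ 5 * phi ^ 3`. -/
theorem sect_zero_euler_pow_five_mul_phi_pow_three : sect 0 (euler ^ 5 * phi ^ 3) =
    euler * phi ^ 7 + 125 * (X * dil 5 (euler ^ 5 * phi ^ 3)) := by
  obtain ⟨u, r, T, h⟩ := exists_parameter_identities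
  apply toField_injective
  have hr := h.r_ne
  have hm := h.m_ne
  have hu := h.u_ne
  have hP := toField_dil_phi_ne
  have key := (((h.euler_sq_sects.mul h.T_eq h.euler_sq_sects).mul h.T_eq
    h.euler_mul_phi_sq_sects).mul h.T_eq h.phi).zero
  rw [show euler ^ 2 * euler ^ 2 * (euler * phi ^ 2) * phi = euler ^ 5 * phi ^ 3 by ring] at key
  simp only [map_mul, map_pow, map_ofNat, map_add]
  rw [h.toField_euler, show ∀ a b c : SeriesField, a * b / c * a ^ 7 = (a ^ 2) ^ 4 * b / c by
    intros; ring, h.phi_sq, key, h.T_curve, h.toField_X]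
  field_simp
  ring

end Identities
end QSeries

namespace QSeries
open PowerSeries Filter Finset

/-! ### Reduction modulo 64. -/

section Congruence

/-- The terms m and -m pair off, the fixed point m = 0 having exponent 0. -/
theorem two_dvd_coeff_phi {n : ℕ} (hn : n ≠ 0) : 2 ∣ coeff n phi := by
  have hs : ∀ m : ℤ, m.natAbs ^ 2 = n → m ∈ Icc (-n : ℤ) n := fun m hm ↦ by
    have : m.natAbs ≤ n := hm ▸ Nat.le_self_pow two_ne_zero _
    rw [mem_Icc]
    omega
  rw [phi, coeff_formalSum_eq_sum _ hs]
  refine (ZMod.intCast_zmod_eq_zero_iff_dvd _ 2).1 ?_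
  rw [Int.cast_sum]
  refine sum_involution (fun m _ ↦ -m) (fun m _ ↦ ?_) (fun m _ hm ↦ ?_) (fun m hm ↦ ?_)
    fun m _ ↦ neg_neg m
  · rw [Int.natAbs_neg, Int.negOnePow_neg]
    exact CharTwo.add_self_eq_zero _
  · rintro h
    obtain rfl : m = 0 := by omega
    exact hm (by simp [hn.symm])
  · rw [mem_Icc] at hm ⊢
    omega

theorem exists_phi_sq_eq : ∃ v : ℤ⟦X⟧, phi ^ 2 = 1 + 4 * v := by
  have h : ∃ w : ℤ⟦X⟧, phi = 1 + 2 * w := by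
    refine ⟨.mk fun n ↦ if n = 0 then 0 else coeff n phi / 2, ?_⟩
    ext n
    rw [map_add, show (2 : ℤ⟦X⟧) = C 2 from rfl, coeff_C_mul, coeff_mk, coeff_one]
    rcases eq_or_ne n 0 with rfl | hn
    · simp [coeff_zero_phi]
    · have := two_dvd_coeff_phi hn
      simp only [hn, if_false]
      omega
  obtain ⟨w, hw⟩ := h
  exact ⟨w + w ^ 2, by rw [hw]; ring⟩

theorem exists_sect_one_eq {v D : ℤ⟦X⟧} (hv : phi ^ 2 = 1 + 4 * v) (hD : D * phi = euler) :
    ∃ K, sect 1 (D - euler * phi ^ 3) = 5 * (dil 5 euler * dil 5 phi ^ 3) -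
      125 * (dil 5 euler * dil 5 phi ^ 7) + 8 * (euler ^ 5 * phi ^ 3 - euler ^ 5 * phi) + 64 * K := by
  -- With Eφ³ = Dφ⁴ and Eφ⁷ = Dφ⁸ the error is D(1 - φ⁴)², and φ⁴ = 1 + 8(v + 2v²).
  have h1 : D - euler * phi ^ 3 =
      euler * phi ^ 3 - euler * phi ^ 7 + C 64 * ((v + 2 * v ^ 2) ^ 2 * D) := by
    rw [show (C 64 : ℤ⟦X⟧) = 64 from rfl, ← hD]
    rw [show D * phi * phi ^ 3 = D * (phi ^ 2) ^ 2 by ring,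
      show D * phi * phi ^ 7 = D * (phi ^ 2) ^ 4 by ring, hv]
    ring
  have h2 : euler ^ 5 * phi = euler ^ 3 * dil 2 euler * phi ^ 2 := by
    linear_combination (-(euler ^ 3 * phi)) * phi_mul
  -- The polynomial is (-12 + 132φ⁴ + 8φ²)/64 written in v, the coefficient of E³E(q²) once 8(E⁵φ³ -
  -- E⁵φ) is set aside.
  refine ⟨euler ^ 3 * dil 2 euler * (2 + 17 * v + 33 * v ^ 2) +
    sect 1 ((v + 2 * v ^ 2) ^ 2 * D), ?_⟩
  rw [h1, sect_add, sect_sub, sect_C_mul, sect_one_euler_mul_phi_pow_three,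
    sect_one_euler_mul_phi_pow_seven, show (C 64 : ℤ⟦X⟧) = 64 from rfl,
    show euler ^ 5 * phi ^ 3 = euler ^ 5 * phi * phi ^ 2 by ring, h2, hv]
  ring

theorem sect_zero_dil_five (f : ℤ⟦X⟧) : sect 0 (dil 5 f) = f := by
  simpa using sect_X_pow_mul_dil (r := 0) (j := 0) (by norm_num) (by norm_num) f

theorem sect_X_mul_dil_five (f : ℤ⟦X⟧) : sect 0 (X * dil 5 f) = 0 ∧
    sect 1 (X * dil 5 f) = f := by
  have h0 := sect_X_pow_mul_dil (r := 0) (j := 1) (by norm_num) (by norm_num) f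
  have h1 := sect_X_pow_mul_dil (r := 1) (j := 1) (by norm_num) (by norm_num) f
  rw [pow_one] at h0 h1
  exact ⟨by simpa using h0, by simpa using h1⟩

theorem exists_sect_eq {D : ℤ⟦X⟧} (hD : D * phi = euler) :
    ∃ G K, sect 1 (sect 0 (sect 1 (D - euler * phi ^ 3))) = dil 5 G + C 64 * K := by
  obtain ⟨v, hv⟩ := exists_phi_sq_eq
  obtain ⟨K, hK⟩ := exists_sect_one_eq hv hD
  have h0 : sect 0 (sect 1 (D - euler * phi ^ 3)) = C 5 * (euler * phi ^ 3) -
      C 117 * (euler * phi ^ 7) - C 8 * (euler * phi ^ 5) +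
      C 1000 * (X * dil 5 (euler ^ 5 * phi ^ 3)) - C 200 * (X * dil 5 (euler ^ 5 * phi)) +
      C 64 * sect 0 K := by
    rw [hK, show (5 : ℤ⟦X⟧) * (dil 5 euler * dil 5 phi ^ 3) -
      125 * (dil 5 euler * dil 5 phi ^ 7) + 8 * (euler ^ 5 * phi ^ 3 - euler ^ 5 * phi) + 64 * K =
      C 5 * dil 5 (euler * phi ^ 3) - C 125 * dil 5 (euler * phi ^ 7) +
        C 8 * (euler ^ 5 * phi ^ 3 - euler ^ 5 * phi) + C 64 * K by
        simp only [map_mul, map_pow]; rfl]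
    simp only [sect_add, sect_sub, sect_C_mul, sect_zero_dil_five,
      sect_zero_euler_pow_five_mul_phi, sect_zero_euler_pow_five_mul_phi_pow_three]
    simp only [show ∀ n : ℤ, (C n : ℤ⟦X⟧) = (n : ℤ⟦X⟧) from
      fun n ↦ map_intCast (C : ℤ →+* ℤ⟦X⟧) n]
    push_cast
    ring
  have h2 : euler ^ 5 * phi = euler ^ 3 * dil 2 euler * phi ^ 2 := by
    linear_combination (-(euler ^ 3 * phi)) * phi_mul
  -- Besides the series in q⁵, every term is a multiple of E³E(q²); the total factor is -60 + 88φ² +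
  -- 17380φ⁴ = 64(272 + 2178v + 4345v²).
  refine ⟨5 * (5 * (euler * phi ^ 3)) - 117 * (125 * (euler * phi ^ 7)) -
    8 * (25 * (euler * phi ^ 5)), sect 1 (sect 0 K) +
    euler ^ 3 * dil 2 euler * (272 + 2178 * v + 4345 * v ^ 2), ?_⟩
  rw [h0]
  simp only [sect_add, sect_sub, sect_C_mul, sect_one_euler_mul_phi_pow_three,
    sect_one_euler_mul_phi_pow_five, sect_one_euler_mul_phi_pow_seven, sect_X_mul_dil_five]
  rw [show euler ^ 5 * phi ^ 3 = euler ^ 5 * phi * phi ^ 2 by ring, h2, hv]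
  simp only [show ∀ n : ℤ, (C n : ℤ⟦X⟧) = (n : ℤ⟦X⟧) from
      fun n ↦ map_intCast (C : ℤ →+* ℤ⟦X⟧) n, map_sub,
    map_mul, map_pow, map_ofNat]
  push_cast
  ring

end Congruence
end QSeries

theorem theorem1p3 (n r : ℕ) (hr₁ : 1 ≤ r) (hr₄ : r ≤ 4) :
    DSOME (625 * n + 125 * r + 26) ≡ 0 [ZMOD 8] := by
  open QSeries PowerSeries in
  obtain ⟨G, K, h⟩ := exists_sect_eq distinctSeries_mul_phi
  rw [← eight_mul_mk_dsome] at h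
  replace h := congrArg (coeff (5 * n + r)) h
  -- As 5 does not divide 5n + r, the series in q⁵ contributes nothing, leaving 8·`DSOME` as a
  -- multiple of 64.
  rw [coeff_sect, coeff_sect, coeff_sect, show (8 : ℤ⟦X⟧) = C 8 from rfl, coeff_C_mul, coeff_mk,
    map_add, coeff_C_mul, coeff_dil, if_neg (by omega), zero_add,
    show 5 * (5 * (5 * (5 * n + r) + 1) + 0) + 1 = 625 * n + 125 * r + 26 by ring] at h
  rw [Int.modEq_zero_iff_dvd]
  omega
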